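/- Let $\delta$ be a real number and $d\ge 0$ an integer. There is $M=M(\delta,d)\ge 0$ such that the following holds for every $d$-dimensional CAT(0) cube complex $X$ (not necessarily locally finite) that is $\delta$-hyperbolic for its $\ell_1$-metric $\mathrm{d}$ (geodesic triangles are $\delta$-slim). Notation. Halfspaces are ordered by inclusion; $h^*$ is the halfspace complementary to $h$ and $\hat h$ is the hyperplane bounding $h$. A pencil is a chain $h_1<\dots<h_n$ of halfspaces (or the sequence of their bounding hyperplanes), and $\hat h\pitchfork\hat k$ means that the hyperplanes $\hat h,\hat k$ cross. A grid of size $m$ is a pair of pencils $\hat h_1,\dots,\hat h_m$ and $\hat k_1,\dots,\hat k_m$ with $\hat h_i\pitchfork\hat k_j$ for all $i,j$. For vertices $x,y$ let $\vec{\mathcal H}(x,y)$ be the set of halfspaces $k$ with $x\notin k\ni y$, let $I(x,y)=\{v : \mathrm{d}(x,y)=\mathrm{d}(x,v)+\mathrm{d}(v,y)\}$, and let $\pi_{I(x,y)}$ be the nearest-point projection to $I(x,y)$. For an integer $D\ge 0$, a halfspace $h$ is $D$-peripheral for $[x,y]$ if $x,y\in h^*$ and every pencil $k_1<\dots<k_n$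 in $\vec{\mathcal H}(x,y)$ with $\hat h\pitchfork\hat k_i$ for all $i$ has $n\le D$; the set of these is $\breve{\mathcal H}_D(x,y)$. For real $r$ let $$\breve{\mathcal H}_{D,r}(x,y)=\{h\in\breve{\mathcal H}_D(x,y) : \max\{\mathrm{d}(x,a) : a\in\pi_{I(x,y)}(h)\}<r\}.$$ Claim. There is a largest integer $D$ such that $X$ contains a grid of size $D$, and for this $D$ and all vertices $x,y,z$ of $X$, $$\bigl|\{\pi_{I(x,y)}(h) : h\in\breve{\mathcal H}_{D,\rho-Dd}(x,y)\setminus\breve{\mathcal H}_D(x,z)\}\bigr|\le M,$$ where $\rho=(y.z)_x=\tfrac12\bigl(\mathrm{d}(x,y)+\mathrm{d}(x,z)-\mathrm{d}(y,z)\bigr)$. -/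

import Mathlib

/-- A (vertex-set presentation of a) cube complex with vertex set `V`: a family of subsets of `V`,
the vertex sets of the cubes, such that every vertex is a cube, every cube is a combinatorial cube
`{0,1}ⁿ` whose faces are exactly the cubes contained in it, and any two cubes meet in a common face
or not at all. -/
structure CubeComplex (V : Type*) where
  cubes : Set (Set V)
  singleton_mem : ∀ v : V, {v} ∈ cubes
  exists_chart : ∀ C ∈ cubes, ∃ (n : ℕ) (φ : (Fin n → Bool) → V),
    Function.Injective φ ∧ Set.range φ = C ∧
      ∀ F : Set V, F ⊆ C →
        (F ∈ cubes ↔ ∃ (S : Set (Fin n)) (a : Fin n → Bool), F = φ '' {t | ∀ i ∈ S, t i = a i})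
  inter_mem : ∀ C ∈ cubes, ∀ C' ∈ cubes, (C ∩ C').Nonempty → C ∩ C' ∈ cubes

namespace CubeComplex

variable {V : Type*} (X : CubeComplex V)

/-- `C` is an `n`-dimensional cube of `X`, that is, a cube with `2 ^ n` vertices. -/
def IsCube (n : ℕ) (C : Set V) : Prop :=
  C ∈ X.cubes ∧ C.ncard = 2 ^ n

/-- The 1-skeleton of `X`. Its path metric `X.graph.dist` is the restriction of the `ℓ₁`-metric
to the vertices. -/
def graph : SimpleGraph V where
  Adj u v := u ≠ v ∧ ({u, v} : Set V) ∈ X.cubes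
  symm := ⟨fun u v h => ⟨h.1.symm, by rw [Set.pair_comm]; exact h.2⟩⟩
  loopless := ⟨fun _ h => h.1 rfl⟩

/-- `X` has dimension `d`. -/
def HasDim (d : ℕ) : Prop :=
  IsGreatest {n | ∃ C, X.IsCube n C} d

/-- Combinatorial homotopy (relative to the endpoints) of edge paths: the equivalence relation
generated by inserting or removing a backtrack, and by replacing a path along two sides of a square
with the path along the two other sides. -/
inductive Homotopic : ∀ {u v : V}, X.graph.Walk u v → X.graph.Walk u v → Prop
  | refl {u v : V} (p : X.graph.Walk u v) : Homotopic p p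
  | symm {u v : V} {p q : X.graph.Walk u v} : Homotopic p q → Homotopic q p
  | trans {u v : V} {p q r : X.graph.Walk u v} :
      Homotopic p q → Homotopic q r → Homotopic p r
  | backtrack {u v a b : V} (p : X.graph.Walk u a) (h : X.graph.Adj a b)
      (q : X.graph.Walk a v) :
      Homotopic (p.append (.cons h (.cons h.symm q))) (p.append q)
  | square {u v a b b' c : V} {C : Set V} (hC : X.IsCube 2 C)
      (ha : a ∈ C) (hb : b ∈ C) (hb' : b' ∈ C) (hc : c ∈ C)
      (p : X.graph.Walk u a) (hab : X.graph.Adj a b) (hbc : X.graph.Adj b c)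
      (hab' : X.graph.Adj a b') (hbc' : X.graph.Adj b' c) (q : X.graph.Walk c v) :
      Homotopic (p.append (.cons hab (.cons hbc q))) (p.append (.cons hab' (.cons hbc' q)))

/-- `X` is connected and its edge-path fundamental group is trivial. -/
def SimplyConnected : Prop :=
  X.graph.Connected ∧ ∀ (v : V) (p : X.graph.Walk v v), X.Homotopic p .nil

/-- The link of every vertex `v` is a flag complex: finitely many edges at `v`, any two of which
span a square, span a cube. -/
def FlagLinks : Prop :=
  ∀ (v : V) (S : Finset V), (∀ u ∈ S, X.graph.Adj v u) →
    (∀ u ∈ S, ∀ w ∈ S, u ≠ w → ∃ C, X.IsCube 2 C ∧ v ∈ C ∧ u ∈ C ∧ w ∈ C) →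
      ∃ C ∈ X.cubes, v ∈ C ∧ ↑S ⊆ C

/-- `X` is a CAT(0) cube complex: it is simply connected and the links of its vertices are flag. -/
def IsCAT0 : Prop :=
  X.SimplyConnected ∧ X.FlagLinks

/-- `X` is `δ`-hyperbolic for the `ℓ₁`-metric: every geodesic triangle with vertices and sides in
the 1-skeleton is `δ`-slim. -/
def Hyperbolic (δ : ℝ) : Prop :=
  ∀ (x y z : V) (p : X.graph.Walk x y) (q : X.graph.Walk y z) (r : X.graph.Walk x z),
    p.length = X.graph.dist x y → q.length = X.graph.dist y z → r.length = X.graph.dist x z →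
      ∀ v ∈ p.support, ∃ w, (w ∈ q.support ∨ w ∈ r.support) ∧ (X.graph.dist v w : ℝ) ≤ δ

/-- `e` and `f` are opposite edges of a square. -/
def Opposite (e f : Sym2 V) : Prop :=
  e ∈ X.graph.edgeSet ∧ f ∈ X.graph.edgeSet ∧
    ∃ C, X.IsCube 2 C ∧ (∀ v ∈ e, v ∈ C) ∧ (∀ v ∈ f, v ∈ C) ∧ ∀ v ∈ e, v ∉ f

/-- A set of edges is (the set of edges dual to) a hyperplane if it is a class of the equivalence
relation on edges generated by being opposite in a square. -/
def IsHyperplane (H : Set (Sym2 V)) : Prop :=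
  ∃ e ∈ X.graph.edgeSet, H = {f | Relation.EqvGen X.Opposite e f}

/-- A halfspace of `X`, given by its bounding hyperplane and by its set of vertices, which is one
of the components left after the edges dual to the hyperplane are cut. The vertices of the
complementary halfspace `h*` are the vertices not in `h`. -/
structure Halfspace where
  hyperplane : Set (Sym2 V)
  carrier : Set V
  isHyperplane : X.IsHyperplane hyperplane
  isComponent : ∃ c : (X.graph.deleteEdges hyperplane).ConnectedComponent, carrier = c.supp

/-- Halfspaces are ordered by inclusion; in particular `h < k` means proper inclusion. -/
instance : Preorder X.Halfspace := Preorder.lift Halfspace.carrier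

/-- Two hyperplanes are transverse (they cross) if they are dual to two adjacent edges of some
square, i.e. their midcubes meet in the centre of that square. -/
def Transverse (H K : Set (Sym2 V)) : Prop :=
  ∃ (C : Set V) (a b c : V), X.IsCube 2 C ∧ a ∈ C ∧ b ∈ C ∧ c ∈ C ∧ b ≠ c ∧
    X.graph.Adj a b ∧ X.graph.Adj a c ∧ s(a, b) ∈ H ∧ s(a, c) ∈ K

/-- `X` contains a grid of size `m`: two pencils of `m` hyperplanes each, every hyperplane of the
first being transverse to every hyperplane of the second. -/
def HasGrid (m : ℕ) : Prop :=
  ∃ h k : Fin m → X.Halfspace, StrictMono h ∧ StrictMono k ∧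
    ∀ i j, X.Transverse (h i).hyperplane (k j).hyperplane

/-- The maximal size `D` of a grid in `X` (meaningful if the sizes of grids are bounded). -/
noncomputable def gridNumber : ℕ :=
  sSup {m | X.HasGrid m}

/-- The halfspaces `k` that separate `x` from `y`, with `x ∉ k` and `y ∈ k`. -/
def sepHalfspaces (x y : V) : Set X.Halfspace :=
  {k | x ∉ k.carrier ∧ y ∈ k.carrier}

/-- The peripheral halfspaces `h` of `x, y`, those with `x, y ∈ h*`. -/
def peripheral (x y : V) : Set X.Halfspace :=
  {h | x ∉ h.carrier ∧ y ∉ h.carrier}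

/-- The intersection number `i(h, 𝓚)`: the maximal size, possibly infinite, of a pencil in `𝓚` of
hyperplanes transverse to the bounding hyperplane of `h`. -/
noncomputable def interNumber (h : X.Halfspace) (K : Set X.Halfspace) : ℕ∞ :=
  sSup {n | ∃ (m : ℕ) (k : Fin m → X.Halfspace), n = (m : ℕ∞) ∧ StrictMono k ∧
    ∀ i, k i ∈ K ∧ X.Transverse h.hyperplane (k i).hyperplane}

/-- The `D`-peripheral halfspaces of `[x, y]`. -/
def peripheralOf (D : ℕ) (x y : V) : Set X.Halfspace :=
  {h | h ∈ X.peripheral x y ∧ X.interNumber h (X.sepHalfspaces x y) ≤ D}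

/-- The vertices of the interval between `x` and `y`. -/
def interval (x y : V) : Set V :=
  {v | X.graph.dist x y = X.graph.dist x v + X.graph.dist v y}

/-- The (vertices of the) projection of the halfspace `h` to the interval `I(x, y)`: the image of
`h` under the nearest-point projection. -/
def proj (x y : V) (h : X.Halfspace) : Set V :=
  {p | p ∈ X.interval x y ∧
    ∃ v ∈ h.carrier, ∀ q ∈ X.interval x y, X.graph.dist v p ≤ X.graph.dist v q}

/-- The Gromov product `(y.z)_x`. -/
noncomputable def gromovProduct (x y z : V) : ℝ :=
  ((X.graph.dist x y : ℝ) + X.graph.dist x z - X.graph.dist y z) / 2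

/-- The `D`-peripheral halfspaces of `[x, y]` all points of whose projection to `I(x, y)` are at
distance less than `r` from `x`. -/
def peripheralNear (D : ℕ) (r : ℝ) (x y : V) : Set X.Halfspace :=
  {h | h ∈ X.peripheralOf D x y ∧ ∀ a ∈ X.proj x y h, (X.graph.dist x a : ℝ) < r}

end CubeComplex

/-!
The proof consists of a development of the halfspaces of a CAT(0) cube complex from the local
definition, and of a count of projections.

Local to global. Consider edge paths up to the moves that replace two sides of a square by the two
other sides. By the flag condition on `3`-cubes, two equivalent paths whose last edges differ can be
moved to end with two sides of one square (`SqEquiv.last_edges`). Hence reducing a path by removing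
backtracks has a well-defined result that depends only on the homotopy class, and, by simple
connectedness, only on the endpoint (`IsCAT0.exists_normalForm`). So the `1`-skeleton is bipartite
(`IsCAT0.dist_adj`) and has the quadrangle property (`IsCAT0.quadrangle`): two edges at `v` that
lead towards `b` span a square. From these two facts, the partition of the vertices into those
nearer to one or to the other end of an edge does not change across a square. The parts are the
halfspaces (`IsCAT0.exists_side`); they are convex, the distance is the number of separating
halfspaces (`IsCAT0.encard_sepSides`), nearest points in convex sets are gates
(`IsCAT0.isGate_of_nearest`), and hyperplanes are transverse exactly when all four intersections of
their halfspaces are nonempty (`IsCAT0.transverse_iff`). Halfspaces separating two vertices have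
width at most `d`, by the flag condition (`IsCAT0.card_antichain_le`), so more than `D * d` of them
contain a pencil of size `D + 1` (`IsCAT0.exists_pencil`).

Grids. A grid of size `m` contains a geodesic triangle that is not `δ`-slim for `δ < m`
(`IsCAT0.le_of_hasGrid`), hence the maximal size `D` exists and is at most `⌊δ⌋₊`.

The count. Let `m` be the projection of `z` to the interval `I(x, y)`, so that `d(x, m) = (y.z)_x`.
If the projection of `h` stays at distance less than `(y.z)_x - D * d` from `x`, then `z` is not in
`h`, and since `h` is not `D`-peripheral for `[x, z]` there is a pencil `k₀ < ⋯ < k_D` separating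
`x` from `z` and crossing `h`, with `y` not in `k₀` because `h` is `D`-peripheral for `[x, y]`.
Points of `h ∩ k₀` project to points at distance more than `D * d` from `m`. A pencil of size
`D + 1` of halfspaces like `k₀` would form a grid of size `D + 1` with halfspaces separating such a
point from `m`, so there are at most `D * d` possibilities for `k₀` (`IsCAT0.ncard_farSides_le`).
Moreover the projection of `h` has diameter at most `D * d` (`IsCAT0.dist_le_of_mem_proj`), and the
projection of a point of `h ∩ k₀` is at distance at most `2 * (D * d)` from the projection of the
gate of `x` in `k₀`, again because otherwise the `kᵢ` would be part of a grid of size `D + 1`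
(`IsCAT0.dist_gate_gate_le`). So the projection of `h` is a subset of one of at most `D * d` balls
of radius `3 * (D * d)` in `I(x, y)`, and such a ball has at most `(2 * d + 1) ^ (3 * (D * d))`
vertices (`IsCAT0.encard_ball_inter_interval_le`).
-/

/-! ### Squares and cubes -/

namespace CubeComplex

variable {V : Type*} (X : CubeComplex V)

/-- The vertices `a, b, c, e` are, in this cyclic order, those of a square of `X`. -/
def Sq (a b c e : V) : Prop :=
  a ≠ c ∧ b ≠ e ∧ X.graph.Adj a b ∧ X.graph.Adj b c ∧ X.graph.Adj c e ∧ X.graph.Adj e a ∧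
    ({a, b, c, e} : Set V) ∈ X.cubes

/-- The vertex of the standard cube obtained from `s` by changing the `i`-th coordinate. -/
def flipAt {n : ℕ} (s : Fin n → Bool) (i : Fin n) : Fin n → Bool :=
  Function.update s i (!s i)

lemma flipAt_ne {n : ℕ} (s : Fin n → Bool) (i : Fin n) : flipAt s i ≠ s := by
  intro h
  have := congrFun h i
  simp [flipAt] at this

lemma flipAt_injective {n : ℕ} (s : Fin n → Bool) : Function.Injective (flipAt s) := by
  intro i j h
  by_contra hij
  have := congrFun h i
  simp [flipAt, Function.update_of_ne hij] at this

lemma flipAt_comm {n : ℕ} (s : Fin n → Bool) {i j : Fin n} (hij : i ≠ j) :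
    flipAt (flipAt s i) j = flipAt (flipAt s j) i := by
  unfold flipAt
  rw [Function.update_of_ne hij.symm, Function.update_of_ne hij, Function.update_comm hij]

variable {X}

namespace Sq

variable {a b c e : V}

lemma rotate (h : X.Sq a b c e) : X.Sq b c e a := by
  obtain ⟨h1, h2, h3, h4, h5, h6, h7⟩ := h
  refine ⟨h2, h1.symm, h4, h5, h6, h3, ?_⟩
  convert h7 using 1
  ext; simp; tauto

lemma reflect (h : X.Sq a b c e) : X.Sq a e c b := by
  obtain ⟨h1, h2, h3, h4, h5, h6, h7⟩ := h
  refine ⟨h1, h2.symm, h6.symm, h5.symm, h4.symm, h3.symm, ?_⟩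
  convert h7 using 1
  ext; simp; tauto

lemma adj₁ (h : X.Sq a b c e) : X.graph.Adj a b := h.2.2.1
lemma adj₂ (h : X.Sq a b c e) : X.graph.Adj b c := h.2.2.2.1
lemma adj₃ (h : X.Sq a b c e) : X.graph.Adj c e := h.2.2.2.2.1
lemma adj₄ (h : X.Sq a b c e) : X.graph.Adj e a := h.2.2.2.2.2.1

lemma ncard_eq (h : X.Sq a b c e) : ({a, b, c, e} : Set V).ncard = 4 := by
  classical
  obtain ⟨h1, h2, h3, h4, h5, h6, -⟩ := h
  have h3 := h3.ne
  have h4 := h4.ne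
  have h5 := h5.ne
  have h6 := h6.ne
  rw [show ({a, b, c, e} : Set V) = (({a, b, c, e} : Finset V) : Set V) by simp,
    Set.ncard_coe_finset, Finset.card_insert_of_notMem (by simp [h1, h3, h6.symm]),
    Finset.card_insert_of_notMem (by simp [h2, h4]), Finset.card_pair h5]

lemma isCube (h : X.Sq a b c e) : X.IsCube 2 {a, b, c, e} :=
  ⟨h.2.2.2.2.2.2, by rw [h.ncard_eq]; norm_num⟩

end Sq

lemma ncard_of_chart {C : Set V} {n : ℕ} {φ : (Fin n → Bool) → V} (hφ : Function.Injective φ)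
    (hC : Set.range φ = C) : C.ncard = 2 ^ n := by
  rw [← hC, ← Set.image_univ, Set.ncard_image_of_injective _ hφ, Set.ncard_univ]
  simp

lemma exists_ncard_eq {C : Set V} (hC : C ∈ X.cubes) : ∃ n, C.ncard = 2 ^ n := by
  obtain ⟨n, φ, hφ, hr, -⟩ := X.exists_chart C hC
  exact ⟨n, ncard_of_chart hφ hr⟩

section Chart

variable {C : Set V} {n : ℕ} {φ : (Fin n → Bool) → V} (hφ : Function.Injective φ)
  (hC : Set.range φ = C)
  (hF : ∀ F : Set V, F ⊆ C →
    (F ∈ X.cubes ↔ ∃ (S : Set (Fin n)) (a : Fin n → Bool), F = φ '' {t | ∀ i ∈ S, t i = a i}))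

include hφ hC hF

/-- Two vertices of a cube are adjacent exactly when they differ in one coordinate. -/
lemma chart_adj_iff (s t : Fin n → Bool) :
    X.graph.Adj (φ s) (φ t) ↔ ∃ i, t = flipAt s i := by
  have hsub : ({φ s, φ t} : Set V) ⊆ C := by
    rw [← hC]; rintro _ (rfl | rfl) <;> exact ⟨_, rfl⟩
  constructor
  · rintro ⟨hne, hmem⟩
    obtain ⟨S, a, hS⟩ := (hF _ hsub).1 hmem
    have hs : ∀ i ∈ S, s i = a i := by
      have : φ s ∈ φ '' {t | ∀ i ∈ S, t i = a i} := hS ▸ (by simp)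
      obtain ⟨r, hr, hrs⟩ := this
      rwa [← hφ hrs]
    have ht : ∀ i ∈ S, t i = a i := by
      have : φ t ∈ φ '' {t | ∀ i ∈ S, t i = a i} := hS ▸ (by simp)
      obtain ⟨r, hr, hrs⟩ := this
      rwa [← hφ hrs]
    have hst : s ≠ t := fun h => hne (by rw [h])
    obtain ⟨i, hi⟩ := Function.ne_iff.1 hst
    have hiS : i ∉ S := fun h => hi (by rw [hs i h, ht i h])
    have : φ (flipAt s i) ∈ ({φ s, φ t} : Set V) := by
      rw [hS]
      refine ⟨_, fun j hj => ?_, rfl⟩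
      have : j ≠ i := fun h => hiS (h ▸ hj)
      simp [flipAt, Function.update_of_ne this, hs j hj]
    rcases this with h | h
    · exact absurd (hφ h) (flipAt_ne s i)
    · exact ⟨i, (hφ h).symm⟩
  · rintro ⟨i, rfl⟩
    refine ⟨fun h => flipAt_ne s i (hφ h).symm, (hF _ hsub).2 ⟨{i}ᶜ, s, ?_⟩⟩
    ext v
    constructor
    · rintro (rfl | rfl)
      · exact ⟨s, fun _ _ => rfl, rfl⟩
      · exact ⟨_, fun j hj => by simp [flipAt, Function.update_of_ne hj], rfl⟩
    · rintro ⟨t, ht, rfl⟩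
      by_cases h : t i = s i
      · left
        congr 1
        ext j
        by_cases hj : j = i
        · rw [hj, h]
        · rw [ht j hj]
      · right
        congr 1
        ext j
        by_cases hj : j = i
        · subst hj
          simp only [flipAt, Function.update_self]
          revert h; cases t j <;> cases s j <;> simp
        · simp [flipAt, Function.update_of_ne hj, ht j hj]

lemma chart_sq (s : Fin n → Bool) {i j : Fin n} (hij : i ≠ j) :
    X.Sq (φ s) (φ (flipAt s i)) (φ (flipAt (flipAt s i) j)) (φ (flipAt s j)) := by
  have hadj := chart_adj_iff hφ hC hF
  have hii : (flipAt s i) i = !s i := by simp [flipAt]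
  have hij' : (flipAt (flipAt s i) j) i = !s i := by
    simp [flipAt, Function.update_of_ne hij]
  refine ⟨fun h => ?_, fun h => hij (flipAt_injective s (hφ h)), (hadj _ _).2 ⟨i, rfl⟩,
    (hadj _ _).2 ⟨j, rfl⟩, ?_, ((hadj _ _).2 ⟨j, rfl⟩).symm, ?_⟩
  · have := congrFun (hφ h) i
    rw [hij'] at this
    simp at this
  · rw [flipAt_comm s hij]
    exact ((hadj _ _).2 ⟨i, rfl⟩).symm
  · have hsub : ({φ s, φ (flipAt s i), φ (flipAt (flipAt s i) j), φ (flipAt s j)} : Set V) ⊆ C := by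
      rw [← hC]; rintro _ (rfl | rfl | rfl | rfl) <;> exact ⟨_, rfl⟩
    refine (hF _ hsub).2 ⟨{i, j}ᶜ, s, ?_⟩
    ext v
    constructor
    · have aux : ∀ k ∈ ({i, j}ᶜ : Set (Fin n)), k ≠ i ∧ k ≠ j := fun k hk => by
        simpa [not_or] using hk
      rintro (rfl | rfl | rfl | rfl)
      · exact ⟨s, fun _ _ => rfl, rfl⟩
      · exact ⟨_, fun k hk => by simp [flipAt, Function.update_of_ne (aux k hk).1], rfl⟩
      · exact ⟨_, fun k hk => by
          simp [flipAt, Function.update_of_ne (aux k hk).1, Function.update_of_ne (aux k hk).2],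
          rfl⟩
      · exact ⟨_, fun k hk => by simp [flipAt, Function.update_of_ne (aux k hk).2], rfl⟩
    · rintro ⟨t, ht, rfl⟩
      have key : t = s ∨ t = flipAt s i ∨ t = flipAt (flipAt s i) j ∨ t = flipAt s j := by
        have hne : ∀ {b c : Bool}, b ≠ c → b = !c := by decide
        have ht' : ∀ k, k ≠ i → k ≠ j → t k = s k := fun k h1 h2 => ht k (by simp [h1, h2])
        by_cases h1 : t i = s i <;> by_cases h2 : t j = s j
        · left
          ext k
          by_cases hk : k = i
          · rw [hk, h1]
          by_cases hk' : k = j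
          · rw [hk', h2]
          rw [ht' k hk hk']
        · right; right; right
          ext k
          by_cases hk' : k = j
          · subst hk'; simp [flipAt, hne h2]
          by_cases hk : k = i
          · subst hk; simp [flipAt, Function.update_of_ne hk', h1]
          simp [flipAt, Function.update_of_ne hk', ht' k hk hk']
        · right; left
          ext k
          by_cases hk : k = i
          · subst hk; simp [flipAt, hne h1]
          by_cases hk' : k = j
          · subst hk'; simp [flipAt, Function.update_of_ne hk, h2]
          simp [flipAt, Function.update_of_ne hk, ht' k hk hk']
        · right; right; left
          ext k
          by_cases hk' : k = j
          · subst hk'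
            simp [flipAt, Function.update_of_ne hij.symm, hne h2]
          by_cases hk : k = i
          · subst hk; simp [flipAt, Function.update_of_ne hk', hne h1]
          simp [flipAt, Function.update_of_ne hk, Function.update_of_ne hk', ht' k hk hk']
      rcases key with rfl | rfl | rfl | rfl <;> simp

end Chart

/-- A square is determined by two adjacent edges. -/
lemma Sq.unique {a b c c' e : V} (h : X.Sq a b c e) (h' : X.Sq a b c' e) : c = c' := by
  have hmem : ({a, b, c, e} : Set V) ∩ {a, b, c', e} ∈ X.cubes :=
    X.inter_mem _ h.isCube.1 _ h'.isCube.1 ⟨a, by simp, by simp⟩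
  obtain ⟨n, hn⟩ := exists_ncard_eq hmem
  have hfin : ({a, b, c, e} : Set V).Finite := by simp
  have hle : (({a, b, c, e} : Set V) ∩ {a, b, c', e}).ncard ≤ 4 :=
    h.ncard_eq ▸ Set.ncard_le_ncard Set.inter_subset_left hfin
  have hab := h.adj₁.ne
  have hea := h.adj₄.ne
  have hbe := h.2.1
  have h3 : 3 ≤ (({a, b, c, e} : Set V) ∩ {a, b, c', e}).ncard := by
    have : ({a, b, e} : Set V).ncard = 3 := Set.ncard_eq_three.2 ⟨a, b, e, hab, hea.symm, hbe, rfl⟩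
    rw [← this]
    refine Set.ncard_le_ncard ?_ (hfin.subset Set.inter_subset_left)
    rintro _ (rfl | rfl | rfl) <;> simp
  have h4 : (({a, b, c, e} : Set V) ∩ {a, b, c', e}).ncard = 4 := by
    rw [hn] at hle h3 ⊢
    have : n ≤ 2 := by
      by_contra hlt
      have := Nat.pow_le_pow_right (n := 2) (by norm_num) (show 3 ≤ n by omega)
      omega
    interval_cases n <;> simp_all
  have heq := Set.eq_of_subset_of_ncard_le (s := ({a, b, c, e} : Set V) ∩ {a, b, c', e})
    (t := {a, b, c, e}) Set.inter_subset_left (by rw [h4, h.ncard_eq]) hfin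
  have hc : c ∈ ({a, b, c, e} : Set V) ∩ {a, b, c', e} := by rw [heq]; simp
  have h1 := h.1
  have h2 := h.adj₂.ne
  have h5 := h.adj₃.ne
  rcases hc.2 with h | h | h | h
  · exact absurd h.symm h1
  · exact absurd h.symm h2
  · exact h
  · exact absurd h h5

/-- Three vertices of a square, listed along it, determine the fourth. -/
lemma Sq.unique_adjacent {a b c e e' : V} (h : X.Sq a b c e) (h' : X.Sq a b c e') : e = e' :=
  h.rotate.unique h'.rotate

lemma IsCube.exists_sq {C : Set V} (hC : X.IsCube 2 C) {a b c : V} (ha : a ∈ C) (hb : b ∈ C)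
    (hc : c ∈ C) (hbc : b ≠ c) (hab : X.graph.Adj a b) (hac : X.graph.Adj a c) :
    ∃ e, X.Sq a b e c ∧ C = {a, b, e, c} := by
  obtain ⟨n, φ, hφ, hr, hF⟩ := X.exists_chart C hC.1
  have hadj := chart_adj_iff hφ hr hF
  rw [← hr] at ha hb hc
  obtain ⟨s, rfl⟩ := ha
  obtain ⟨t, rfl⟩ := hb
  obtain ⟨u, rfl⟩ := hc
  obtain ⟨i, rfl⟩ := (hadj _ _).1 hab
  obtain ⟨j, rfl⟩ := (hadj _ _).1 hac
  have hij : i ≠ j := fun h => hbc (by rw [h])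
  have hsq := chart_sq hφ hr hF s hij
  refine ⟨_, hsq, (Set.eq_of_subset_of_ncard_le ?_ ?_ ?_).symm⟩
  · rw [← hr]; rintro _ (rfl | rfl | rfl | rfl) <;> exact ⟨_, rfl⟩
  · rw [hsq.ncard_eq, hC.2]; norm_num
  · exact Set.finite_of_ncard_ne_zero (by rw [hC.2]; norm_num)

lemma IsCube.exists_sq_of_edge {C : Set V} (hC : X.IsCube 2 C) {a b : V} (ha : a ∈ C) (hb : b ∈ C)
    (hab : X.graph.Adj a b) : ∃ c e, X.Sq a b c e ∧ C = {a, b, c, e} := by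
  obtain ⟨n, φ, hφ, hr, hF⟩ := X.exists_chart C hC.1
  have hadj := chart_adj_iff hφ hr hF
  have hn : n = 2 := by
    have := ncard_of_chart hφ hr
    rw [hC.2] at this
    exact (Nat.pow_right_injective le_rfl this).symm
  have ha' := ha
  have hb' := hb
  rw [← hr] at ha hb
  obtain ⟨s, rfl⟩ := ha
  obtain ⟨t, rfl⟩ := hb
  obtain ⟨i, rfl⟩ := (hadj _ _).1 hab
  obtain ⟨j, hij⟩ : ∃ j, i ≠ j := by
    subst hn
    exact (show ∀ i : Fin 2, ∃ j, i ≠ j by decide) i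
  obtain ⟨e, h1, h2⟩ := hC.exists_sq ha' hb' (c := φ (flipAt s j)) (hr ▸ ⟨_, rfl⟩)
    (fun h => hij (flipAt_injective s (hφ h))) hab ((hadj _ _).2 ⟨j, rfl⟩)
  exact ⟨_, _, h1, h2⟩

lemma Sq.opposite {a b c e : V} (h : X.Sq a b c e) : X.Opposite s(a, b) s(c, e) := by
  have h1 := h.1
  have h2 := h.2.1
  have h3 := h.adj₂.ne
  have h4 := h.adj₄.ne
  refine ⟨h.adj₁, h.adj₃, _, h.isCube, ?_, ?_, ?_⟩
  · simp
  · simp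
  · simp [h1, h2, h3, h4.symm]

lemma Opposite.sq {a b c e : V} (h : X.Opposite s(a, b) s(c, e)) :
    X.Sq a b c e ∨ X.Sq a b e c := by
  obtain ⟨h1, h2, C, hC, h3, h4, h5⟩ := h
  obtain ⟨p, q, hsq, rfl⟩ := hC.exists_sq_of_edge (h3 a (by simp)) (h3 b (by simp)) h1
  have hc := h4 c (by simp)
  have he := h4 e (by simp)
  have hce : c ≠ e := SimpleGraph.Adj.ne (G := X.graph) h2
  have ha : a ≠ c ∧ a ≠ e := by simpa using h5 a (by simp)
  have hb : b ≠ c ∧ b ≠ e := by simpa using h5 b (by simp)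
  simp only [Set.mem_insert_iff, Set.mem_singleton_iff] at hc he
  rcases hc with rfl | rfl | rfl | rfl <;> rcases he with rfl | rfl | rfl | rfl <;>
    first | exact Or.inl hsq | exact Or.inr hsq | simp_all

/-- The cube condition: three squares around a vertex, any two of which share an edge, lie in a
`3`-cube. -/
lemma FlagLinks.cube_condition (hX : X.FlagLinks) {u x y z p q r : V} (h1 : X.Sq u x p y)
    (h2 : X.Sq u y q z) (h3 : X.Sq u x r z) :
    ∃ o, X.Sq x p o r ∧ X.Sq y p o q ∧ X.Sq z q o r := by
  classical
  obtain ⟨C, hC, hu, hsub⟩ := hX u {x, y, z} (by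
      simp only [Finset.mem_insert, Finset.mem_singleton]
      rintro _ (rfl | rfl | rfl)
      exacts [h1.adj₁, h2.adj₁, h3.adj₄.symm]) (by
      simp only [Finset.mem_insert, Finset.mem_singleton]
      rintro _ (rfl | rfl | rfl) _ (rfl | rfl | rfl) hne
      · exact absurd rfl hne
      · exact ⟨_, h1.isCube, by simp⟩
      · exact ⟨_, h3.isCube, by simp⟩
      · exact ⟨_, h1.isCube, by simp⟩
      · exact absurd rfl hne
      · exact ⟨_, h2.isCube, by simp⟩
      · exact ⟨_, h3.isCube, by simp⟩
      · exact ⟨_, h2.isCube, by simp⟩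
      · exact absurd rfl hne)
  obtain ⟨n, φ, hφ, hr, hF⟩ := X.exists_chart C hC
  have hadj := chart_adj_iff hφ hr hF
  have hsq := fun s i j hij => chart_sq hφ hr hF s (i := i) (j := j) hij
  have hx : x ∈ Set.range φ := hr ▸ hsub (by simp)
  have hy : y ∈ Set.range φ := hr ▸ hsub (by simp)
  have hz : z ∈ Set.range φ := hr ▸ hsub (by simp)
  rw [← hr] at hu
  obtain ⟨s, rfl⟩ := hu
  obtain ⟨_, rfl⟩ := hx
  obtain ⟨_, rfl⟩ := hy
  obtain ⟨_, rfl⟩ := hz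
  obtain ⟨i, rfl⟩ := (hadj _ _).1 h1.adj₁
  obtain ⟨j, rfl⟩ := (hadj _ _).1 h2.adj₁
  obtain ⟨k, rfl⟩ := (hadj _ _).1 h3.adj₄.symm
  have hij : i ≠ j := fun h => h1.2.1 (by rw [h])
  have hjk : j ≠ k := fun h => h2.2.1 (by rw [h])
  have hik : i ≠ k := fun h => h3.2.1 (by rw [h])
  obtain rfl := h1.unique (hsq s i j hij)
  obtain rfl := h2.unique (hsq s j k hjk)
  obtain rfl := h3.unique (hsq s i k hik)
  refine ⟨φ (flipAt (flipAt (flipAt s i) j) k), hsq _ j k hjk, ?_, ?_⟩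
  · rw [flipAt_comm s hij]
    exact hsq _ i k hik
  · have ho : flipAt (flipAt (flipAt s i) j) k = flipAt (flipAt (flipAt s k) j) i := by
      rw [flipAt_comm _ hjk, flipAt_comm s hik, flipAt_comm _ hij]
    rw [ho, flipAt_comm s hik, flipAt_comm s hjk]
    exact hsq (flipAt s k) j i hij.symm

/-- If `X` has dimension `d`, then at most `d` edges at a vertex span squares pairwise. -/
lemma FlagLinks.card_le (hX : X.FlagLinks) {d : ℕ} (hd : X.HasDim d) (v : V) (S : Finset V)
    (hadj : ∀ u ∈ S, X.graph.Adj v u)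
    (hS : ∀ u ∈ S, ∀ w ∈ S, u ≠ w → ∃ e, X.Sq v u e w) : S.card ≤ d := by
  obtain ⟨C, hC, hv, hsub⟩ := hX v S hadj fun u hu w hw hne => by
    obtain ⟨e, he⟩ := hS u hu w hw hne
    exact ⟨_, he.isCube, by simp⟩
  obtain ⟨n, φ, hφ, hr, hF⟩ := X.exists_chart C hC
  have hcadj := chart_adj_iff hφ hr hF
  have hn : n ≤ d := hd.2 ⟨C, hC, ncard_of_chart hφ hr⟩
  refine le_trans ?_ hn
  rw [← hr] at hv hsub
  obtain ⟨s, rfl⟩ := hv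
  have : ∀ u ∈ S, ∃ i, u = φ (flipAt s i) := fun u hu => by
    obtain ⟨t, rfl⟩ := hsub hu
    obtain ⟨i, rfl⟩ := (hcadj _ _).1 (hadj _ hu)
    exact ⟨i, rfl⟩
  choose f hf using this
  have hinj : Function.Injective fun u : S => f u u.2 := fun u w h => by
    ext
    rw [hf u u.2, hf w w.2]
    simp only at h
    rw [h]
  simpa using Fintype.card_le_of_injective _ hinj

end CubeComplex

/-! ### Edge paths up to square moves -/

namespace CubeComplex

variable {V : Type*} (X : CubeComplex V)

/-- One square move on an edge path. An edge path is encoded as the list of its vertices in reverse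
order, so that its endpoint comes first. -/
inductive SqStep : List V → List V → Prop
  | square {a b c b' : V} (l : List V) (h : X.Sq a b c b') :
      SqStep (c :: b :: a :: l) (c :: b' :: a :: l)
  | cons (v : V) {l l' : List V} (h : SqStep l l') : SqStep (v :: l) (v :: l')

/-- Two (reversed) edge paths are equivalent if they differ by square moves. -/
def SqEquiv : List V → List V → Prop := Relation.ReflTransGen X.SqStep

variable {X}

lemma SqStep.symm {l l' : List V} (h : X.SqStep l l') : X.SqStep l' l := by
  induction h with
  | square l h => exact .square l h.reflect
  | cons v _ ih => exact .cons v ih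

lemma SqStep.length_eq {l l' : List V} (h : X.SqStep l l') : l.length = l'.length := by
  induction h <;> simp_all

namespace SqEquiv

variable {l l' l'' : List V}

lemma refl (l : List V) : X.SqEquiv l l := Relation.ReflTransGen.refl

lemma symm (h : X.SqEquiv l l') : X.SqEquiv l' l := by
  induction h with
  | refl => exact Relation.ReflTransGen.refl
  | tail _ h ih => exact .head h.symm ih

lemma trans (h : X.SqEquiv l l') (h' : X.SqEquiv l' l'') : X.SqEquiv l l'' :=
  Relation.ReflTransGen.trans h h'

lemma cons (v : V) (h : X.SqEquiv l l') : X.SqEquiv (v :: l) (v :: l') := by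
  induction h with
  | refl => exact Relation.ReflTransGen.refl
  | tail _ h ih => exact .tail ih (.cons v h)

lemma square {a b c b' : V} (l : List V) (h : X.Sq a b c b') :
    X.SqEquiv (c :: b :: a :: l) (c :: b' :: a :: l) :=
  .single (.square l h)

lemma length_eq (h : X.SqEquiv l l') : l.length = l'.length := by
  induction h with
  | refl => rfl
  | tail _ h ih => rw [ih, h.length_eq]

lemma head_eq {v : V} (h : X.SqEquiv (v :: l) l') : ∃ t, l' = v :: t := by
  induction h with
  | refl => exact ⟨_, rfl⟩
  | tail _ h ih =>
    obtain ⟨t, rfl⟩ := ih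
    cases h with
    | square l h => exact ⟨_, rfl⟩
    | cons v h => exact ⟨_, rfl⟩

/-- If two equivalent paths end with different edges, then these edges are adjacent edges of a
square, and both paths are equivalent to paths ending with two sides of that square; equivalent
paths with the same last edge stay equivalent when that edge is removed. The induction is along the
sequence of square moves, inside an induction on the length; the cube condition fills in the corner
between three successive last edges. -/
theorem last_edges (hX : X.FlagLinks) {v u : V} {l L : List V}
    (h : X.SqEquiv (v :: u :: l) L) :
    ∃ u' l', L = v :: u' :: l' ∧ ((u = u' ∧ X.SqEquiv (u :: l) (u' :: l')) ∨
      ∃ w t, X.Sq w u v u' ∧ X.SqEquiv (u :: l) (u :: w :: t) ∧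
        X.SqEquiv (u' :: l') (u' :: w :: t)) := by
  induction hn : l.length using Nat.strong_induction_on generalizing v u l L with
  | _ n ihn =>
  subst hn
  induction h with
  | refl => exact ⟨u, l, rfl, .inl ⟨rfl, .refl _⟩⟩
  | tail hM hstep ih =>
    obtain ⟨u₁, l₁, rfl, ih⟩ := ih
    cases hstep with
    | cons _ hstep =>
      obtain ⟨l₂, rfl⟩ := head_eq (.single hstep)
      refine ⟨u₁, l₂, rfl, ?_⟩
      rcases ih with ⟨rfl, ih⟩ | ⟨w, t, hsq, h1, h2⟩
      · exact .inl ⟨rfl, ih.trans (.single hstep)⟩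
      · exact .inr ⟨w, t, hsq, h1, trans (.single hstep.symm) h2⟩
    | @square a _ _ u₂ l₀ hsq' =>
      refine ⟨u₂, a :: l₀, rfl, ?_⟩
      rcases ih with ⟨rfl, ih⟩ | ⟨w, t, hsq, h1, h2⟩
      · exact .inr ⟨a, l₀, hsq', ih, .refl _⟩
      · have hlen : l₀.length < l.length := by
          have := length_eq hM
          simp at this
          omega
        obtain ⟨w₂, t₂, heq, h3⟩ := ihn _ hlen h2 rfl
        obtain ⟨rfl, rfl⟩ : w = w₂ ∧ t = t₂ := by simpa using heq
        rcases h3 with ⟨rfl, h3⟩ | ⟨w', t', hsq'', h3, h4⟩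
        · obtain rfl : u = u₂ := hsq.reflect.unique_adjacent hsq'
          exact .inl ⟨rfl, h1.trans (h3.symm.cons _)⟩
        · -- the squares `u₁ v u w`, `u₁ v u₂ a` and `u₁ w w' a` meet at `u₁`
          obtain ⟨o, ho1, ho2, ho3⟩ := hX.cube_condition (u := u₁) (x := v) (y := w) (z := a)
            (p := u) (q := w') (r := u₂) hsq.rotate.rotate.rotate.reflect hsq''.rotate.rotate
            hsq'.rotate
          refine .inr ⟨o, w' :: t', ?_, ?_, ?_⟩
          · exact ho1.rotate.rotate.reflect
          · exact h1.trans ((h4.cons _).trans (.square _ ho2.rotate.rotate.rotate))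
          · exact (h3.cons _).trans (.square _ ho3.reflect.rotate.rotate.rotate)

/-- Removing the last edge from equivalent paths. -/
lemma tail (hX : X.FlagLinks) {v u : V} (h : X.SqEquiv (v :: u :: l) (v :: u :: l')) :
    X.SqEquiv (u :: l) (u :: l') := by
  obtain ⟨u', l'', heq, h'⟩ := h.last_edges hX
  obtain ⟨rfl, rfl⟩ : u = u' ∧ l' = l'' := by simpa using heq
  rcases h' with ⟨-, h⟩ | ⟨w, t, hsq, -, -⟩
  · exact h
  · exact absurd rfl hsq.2.1

lemma exists_sq (hX : X.FlagLinks) {v u u' : V} (h : X.SqEquiv (v :: u :: l) (v :: u' :: l'))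
    (hne : u ≠ u') : ∃ w t, X.Sq w u v u' ∧ X.SqEquiv (u :: l) (u :: w :: t) ∧
        X.SqEquiv (u' :: l') (u' :: w :: t) := by
  obtain ⟨u₂, l'', heq, h'⟩ := h.last_edges hX
  obtain ⟨rfl, rfl⟩ : u' = u₂ ∧ l' = l'' := by simpa using heq
  rcases h' with ⟨h', -⟩ | h'
  · exact absurd h' hne
  · exact h'

end SqEquiv

/-- The path contains a backtrack. -/
inductive HasBacktrack : List V → Prop
  | back (a b : V) (l : List V) : HasBacktrack (a :: b :: a :: l)
  | cons (v : V) {l : List V} (h : HasBacktrack l) : HasBacktrack (v :: l)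

variable (X) in
/-- A path is reduced if no sequence of square moves creates a backtrack. -/
def Reduced (l : List V) : Prop := ∀ l', X.SqEquiv l l' → ¬ HasBacktrack l'

lemma Reduced.congr {l l' : List V} (h : X.Reduced l) (hl : X.SqEquiv l l') : X.Reduced l' :=
  fun _ h' => h _ (hl.trans h')

lemma Reduced.tail {v : V} {l : List V} (h : X.Reduced (v :: l)) : X.Reduced l :=
  fun _ h' hb => h _ (h'.cons v) (hb.cons v)

/-- If a reduced path stops being reduced after one more edge, then it is equivalent to a path
ending with the reverse of that edge. -/
theorem Reduced.exists_of_not_cons (hX : X.FlagLinks) {v u : V} {l : List V}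
    (h : X.Reduced (u :: l)) (hn : ¬ X.Reduced (v :: u :: l)) :
    ∃ q, X.SqEquiv (u :: l) (u :: v :: q) := by
  induction hlen : l.length using Nat.strong_induction_on generalizing v u l with
  | _ n ih =>
  subst hlen
  simp only [Reduced, not_forall, not_not] at hn
  obtain ⟨L, hL, hb⟩ := hn
  cases hb with
  | back a b q =>
    obtain ⟨_, heq⟩ := hL.head_eq
    obtain rfl : a = v := by simpa using (List.cons.inj heq).1
    by_cases hub : u = b
    · subst hub
      exact ⟨q, hL.tail hX⟩
    · exfalso
      obtain ⟨w, t, hsq, h1, h2⟩ := hL.exists_sq hX hub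
      obtain ⟨w', t', hsq', h3, h4⟩ := h2.exists_sq hX hsq.1.symm
      obtain rfl : u = w' := hsq.rotate.rotate.unique_adjacent hsq'.rotate
      exact h _ (h1.trans (h4.cons _)) (.back _ _ _)
  | cons a hb =>
    rename_i l''
    obtain ⟨_, heq⟩ := hL.head_eq
    obtain ⟨rfl, rfl⟩ := List.cons.inj heq
    obtain ⟨u', l', heq', hcase⟩ := hL.last_edges hX
    obtain rfl := (List.cons.inj heq').2
    rcases hcase with ⟨rfl, h1⟩ | ⟨w, t, hsq, h1, h2⟩
    · exact absurd hb (h _ h1)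
    · have hr : X.Reduced (w :: t) := (h.congr h1).tail
      have hnr : ¬ X.Reduced (u' :: w :: t) := fun hr' => hr' _ h2.symm hb
      have hlt : t.length < l.length := by
        have := h1.length_eq
        simp at this
        omega
      obtain ⟨q, hq⟩ := ih _ hlt hr hnr rfl
      exact ⟨u' :: q, h1.trans ((hq.cons u).trans (.square _ hsq.reflect.rotate.reflect))⟩

end CubeComplex

/-! ### Normal forms of edge paths -/

namespace CubeComplex

variable {V : Type*} {X : CubeComplex V}

open Classical in
variable (X) in
/-- Extend a path by one edge to `v`, or shorten it if it is equivalent to a path ending with the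
reverse of that edge. -/
noncomputable def extend : List V → V → List V
  | [], v => [v]
  | u :: l, v => if h : ∃ q, X.SqEquiv (u :: l) (u :: v :: q) then v :: h.choose else v :: u :: l

variable (X) in
lemma extend_head (l : List V) (v : V) : ∃ t, X.extend l v = v :: t := by
  cases l with
  | nil => exact ⟨_, rfl⟩
  | cons u l => simp only [extend]; split <;> exact ⟨_, rfl⟩

variable (X) in
lemma extend_ne_nil (l : List V) (v : V) : X.extend l v ≠ [] := by
  obtain ⟨t, ht⟩ := X.extend_head l v
  simp [ht]

lemma extend_of_exists (hX : X.FlagLinks) {u v : V} {l q : List V}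
    (h : X.SqEquiv (u :: l) (u :: v :: q)) : X.SqEquiv (X.extend (u :: l) v) (v :: q) := by
  have h' : ∃ q, X.SqEquiv (u :: l) (u :: v :: q) := ⟨q, h⟩
  rw [extend, dif_pos h']
  exact (h'.choose_spec.symm.trans h).tail hX

lemma extend_of_not_exists {u v : V} {l : List V}
    (h : ¬ ∃ q, X.SqEquiv (u :: l) (u :: v :: q)) : X.extend (u :: l) v = v :: u :: l := by
  rw [extend, dif_neg h]

lemma extend_congr (hX : X.FlagLinks) {v : V} {l l' : List V} (h : X.SqEquiv l l')
    (hr : l ≠ []) : X.SqEquiv (X.extend l v) (X.extend l' v) := by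
  obtain ⟨u, l, rfl⟩ := List.exists_cons_of_ne_nil hr
  obtain ⟨l', rfl⟩ := h.head_eq
  by_cases hq : ∃ q, X.SqEquiv (u :: l) (u :: v :: q)
  · obtain ⟨q, hq⟩ := hq
    exact (extend_of_exists hX hq).trans (extend_of_exists hX (h.symm.trans hq)).symm
  · rw [extend_of_not_exists hq,
      extend_of_not_exists fun ⟨q, hq'⟩ => hq ⟨q, h.trans hq'⟩]
    exact h.cons v

lemma Reduced.extend (hX : X.FlagLinks) {u v : V} {l : List V} (h : X.Reduced (u :: l)) :
    X.Reduced (X.extend (u :: l) v) := by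
  by_cases hq : ∃ q, X.SqEquiv (u :: l) (u :: v :: q)
  · obtain ⟨q, hq⟩ := hq
    exact (h.congr hq).tail.congr (extend_of_exists hX hq).symm
  · rw [extend_of_not_exists hq]
    by_contra hn
    exact hq (h.exists_of_not_cons hX hn)

lemma extend_extend_backtrack (hX : X.FlagLinks) {u v : V} {l : List V} (h : X.Reduced (u :: l)) :
    X.SqEquiv (X.extend (X.extend (u :: l) v) u) (u :: l) := by
  by_cases hq : ∃ q, X.SqEquiv (u :: l) (u :: v :: q)
  · obtain ⟨q, hq⟩ := hq
    refine (extend_congr hX (extend_of_exists hX hq) (X.extend_ne_nil _ _)).trans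
      (.trans ?_ hq.symm)
    rw [extend_of_not_exists]
    · exact .refl _
    · rintro ⟨q', hq'⟩
      exact h _ (hq.trans (hq'.cons u)) (.back _ _ _)
  · rw [extend_of_not_exists hq]
    exact extend_of_exists hX (.refl _)

/-- If a path extended along the side `ab` of a square can be shortened towards the vertex `c`
opposite to `a`, then the path itself can be shortened along the other side at `a`. -/
lemma exists_of_extend_square (hX : X.FlagLinks) {a b c b' : V} (hsq : X.Sq a b c b')
    {l q : List V} (hq : X.SqEquiv (b :: a :: l) (b :: c :: q)) :
    ∃ t, X.SqEquiv (a :: l) (a :: b' :: t) := by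
  obtain ⟨w, t, hw, h1, -⟩ := hq.exists_sq hX hsq.1
  obtain rfl : b' = w := hsq.unique_adjacent hw.rotate
  exact ⟨t, h1⟩

/-- Extending a path along the two ways around a square gives the same result. -/
lemma extend_square (hX : X.FlagLinks) {a b c b' : V} (hsq : X.Sq a b c b') {l : List V} :
    X.SqEquiv (X.extend (X.extend (a :: l) b) c) (X.extend (X.extend (a :: l) b') c) := by
  -- the case of a path that is shortened by its extension to `b`
  have key : ∀ {b b'}, X.Sq a b c b' → ∀ {q}, X.SqEquiv (a :: l) (a :: b :: q) →
      X.SqEquiv (X.extend (X.extend (a :: l) b) c) (X.extend (X.extend (a :: l) b') c) := by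
    intro b b' hsq q hq
    have h1 := extend_congr hX (v := c) (extend_of_exists hX hq) (X.extend_ne_nil _ _)
    by_cases hq' : ∃ q', X.SqEquiv (a :: l) (a :: b' :: q')
    · obtain ⟨q', hq'⟩ := hq'
      have h2 := extend_congr hX (v := c) (extend_of_exists hX hq') (X.extend_ne_nil _ _)
      obtain ⟨w, t, hw, h3, h4⟩ := (hq.symm.trans hq').exists_sq hX hsq.2.1
      obtain rfl : c = w := hsq.unique hw.rotate.rotate.reflect
      exact h1.trans ((extend_of_exists hX h3).trans
        (h2.trans (extend_of_exists hX h4)).symm)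
    · rw [extend_of_not_exists hq']
      have h3 : X.SqEquiv (b' :: a :: l) (b' :: c :: b :: q) :=
        (hq.cons b').trans (.square _ hsq.reflect.rotate.rotate.rotate)
      have h4 : ¬ ∃ q', X.SqEquiv (b :: q) (b :: c :: q') := by
        rintro ⟨q', h4⟩
        exact hq' ⟨_, hq.trans ((h4.cons a).trans (.square _ hsq.rotate.rotate.reflect))⟩
      rw [extend_of_not_exists h4] at h1
      exact h1.trans (extend_of_exists hX h3).symm
  by_cases hb : ∃ q, X.SqEquiv (a :: l) (a :: b :: q)
  · exact key hsq hb.choose_spec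
  by_cases hb' : ∃ q, X.SqEquiv (a :: l) (a :: b' :: q)
  · exact (key hsq.reflect hb'.choose_spec).symm
  rw [extend_of_not_exists hb, extend_of_not_exists hb', extend_of_not_exists,
    extend_of_not_exists]
  · exact .square _ hsq
  · rintro ⟨q, hq⟩
    exact hb (exists_of_extend_square hX hsq.reflect hq)
  · rintro ⟨q, hq⟩
    exact hb' (exists_of_extend_square hX hsq hq)

variable (X) in
/-- Extend a path successively by the edges of a walk. -/
noncomputable def walkExtend {u v : V} : List V → X.graph.Walk u v → List V
  | l, .nil => l
  | l, .cons (v := w) _ p => walkExtend (X.extend l w) p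

lemma walkExtend_append {u v w : V} (l : List V) (p : X.graph.Walk u v) (q : X.graph.Walk v w) :
    X.walkExtend l (p.append q) = X.walkExtend (X.walkExtend l p) q := by
  induction p generalizing l with
  | nil => rfl
  | cons h p ih => simp [walkExtend, ih]

lemma walkExtend_congr (hX : X.FlagLinks) {u v : V} {l l' : List V} (h : X.SqEquiv l l')
    (hl : l ≠ []) (p : X.graph.Walk u v) :
    X.SqEquiv (X.walkExtend l p) (X.walkExtend l' p) := by
  induction p generalizing l l' with
  | nil => exact h
  | cons _ p ih => exact ih (extend_congr hX h hl) (X.extend_ne_nil _ _)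

lemma Reduced.walkExtend (hX : X.FlagLinks) {u v : V} {l : List V} (h : X.Reduced (u :: l))
    (p : X.graph.Walk u v) : ∃ t, X.walkExtend (u :: l) p = v :: t ∧ X.Reduced (v :: t) := by
  induction p generalizing l with
  | nil => exact ⟨l, rfl, h⟩
  | @cons u w v _ p ih =>
    obtain ⟨t, ht⟩ := X.extend_head (u :: l) w
    have := h.extend hX (v := w)
    rw [ht] at this
    simpa only [CubeComplex.walkExtend, ht] using ih this

/-- Homotopic walks extend a reduced path to equivalent paths. -/
lemma Homotopic.walkExtend (hX : X.FlagLinks) {u v : V} {p q : X.graph.Walk u v}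
    (h : X.Homotopic p q) {l : List V} (hl : X.Reduced (u :: l)) :
    X.SqEquiv (X.walkExtend (u :: l) p) (X.walkExtend (u :: l) q) := by
  induction h generalizing l with
  | refl p => exact .refl _
  | symm _ ih => exact (ih hl).symm
  | trans _ _ ih ih' => exact (ih hl).trans (ih' hl)
  | backtrack p h q =>
    obtain ⟨t, ht, hr⟩ := hl.walkExtend hX p
    simp only [walkExtend_append, ht, CubeComplex.walkExtend]
    exact walkExtend_congr hX (extend_extend_backtrack hX hr) (X.extend_ne_nil _ _) q
  | @square a b b' c C hC ha hb hb' hc p hab hbc hab' hbc' q =>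
    obtain ⟨t, ht, hr⟩ := hl.walkExtend hX p
    simp only [walkExtend_append, ht, CubeComplex.walkExtend]
    refine walkExtend_congr hX ?_ (X.extend_ne_nil _ _) q
    by_cases hbb : b = b'
    · subst hbb
      exact .refl _
    by_cases hac : a = c
    · subst hac
      exact (extend_extend_backtrack hX hr).trans (extend_extend_backtrack hX hr).symm
    obtain ⟨e, hsq, rfl⟩ := hC.exists_sq ha hb hb' hbb hab hab'
    have h1 := hbc.ne
    have h2 := hbc'.ne
    obtain rfl : c = e := by
      simp only [Set.mem_insert_iff, Set.mem_singleton_iff] at hc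
      rcases hc with h | h | h | h
      · exact absurd h.symm hac
      · exact absurd h.symm h1
      · exact h
      · exact absurd h.symm h2
    exact extend_square hX hsq

lemma walkExtend_reverse_walkExtend (hX : X.FlagLinks) {u v : V} {l : List V}
    (h : X.Reduced (v :: l)) (p : X.graph.Walk u v) :
    X.SqEquiv (X.walkExtend (X.walkExtend (v :: l) p.reverse) p) (v :: l) := by
  induction p with
  | nil => exact .refl _
  | cons hadj p ih =>
    obtain ⟨t, ht, hr⟩ := h.walkExtend hX p.reverse
    simp only [SimpleGraph.Walk.reverse_cons, walkExtend_append, CubeComplex.walkExtend]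
    refine .trans ?_ (ih h)
    rw [ht]
    exact walkExtend_congr hX (extend_extend_backtrack hX hr) (X.extend_ne_nil _ _) p

lemma reduced_singleton (v : V) : X.Reduced [v] := by
  intro l h hb
  have := h.length_eq
  cases hb with
  | back => simp at this
  | cons v h' =>
    obtain rfl : _ = [] := by simpa using this
    cases h'

lemma SimplyConnected.walkExtend_equiv (hX : X.FlagLinks) (hs : X.SimplyConnected) {u v : V}
    (p q : X.graph.Walk u v) : X.SqEquiv (X.walkExtend [u] p) (X.walkExtend [u] q) := by
  have hu := reduced_singleton (X := X) u
  obtain ⟨t, ht, hr⟩ := hu.walkExtend hX p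
  obtain ⟨s, hs', hr'⟩ := hu.walkExtend hX (p.append q.reverse)
  have h1 := walkExtend_reverse_walkExtend hX hr q
  rw [← ht, ← walkExtend_append [u] p] at h1
  have h2 := (hs.2 u (p.append q.reverse)).walkExtend hX hu
  exact h1.symm.trans (walkExtend_congr hX h2 (by simp [hs']) q)

variable (X) in
/-- The list is the list of vertices, in reverse order, of an edge path starting at `b`. -/
inductive IsPathFrom (b : V) : List V → Prop
  | base : IsPathFrom b [b]
  | cons {u v : V} {l : List V} (h : IsPathFrom b (u :: l)) (hadj : X.graph.Adj u v) :
      IsPathFrom b (v :: u :: l)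

lemma IsPathFrom.step {b : V} {l l' : List V} (h : X.IsPathFrom b l) (hl : X.SqStep l l') :
    X.IsPathFrom b l' := by
  induction hl with
  | square l hsq =>
    cases h with
    | cons h hadj =>
      cases h with
      | cons h hadj' => exact .cons (.cons h hsq.adj₄.symm) hsq.adj₃.symm
  | cons v hl ih =>
    cases h with
    | base => cases hl
    | cons h hadj =>
      obtain ⟨t, rfl⟩ := SqEquiv.head_eq (.single hl)
      exact .cons (ih h) hadj

lemma IsPathFrom.congr {b : V} {l l' : List V} (h : X.IsPathFrom b l) (hl : X.SqEquiv l l') :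
    X.IsPathFrom b l' := by
  induction hl with
  | refl => exact h
  | tail _ hs ih => exact ih.step hs

lemma IsPathFrom.extend (hX : X.FlagLinks) {b u v : V} {l : List V} (h : X.IsPathFrom b (u :: l))
    (hadj : X.graph.Adj u v) : X.IsPathFrom b (X.extend (u :: l) v) := by
  by_cases hq : ∃ q, X.SqEquiv (u :: l) (u :: v :: q)
  · obtain ⟨q, hq⟩ := hq
    have := h.congr hq
    cases this with
    | cons h' _ => exact h'.congr (extend_of_exists hX hq).symm
  · rw [extend_of_not_exists hq]
    exact .cons h hadj

lemma IsPathFrom.walkExtend (hX : X.FlagLinks) {b u v : V} {l : List V}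
    (h : X.IsPathFrom b (u :: l)) (p : X.graph.Walk u v) :
    X.IsPathFrom b (X.walkExtend (u :: l) p) := by
  induction p generalizing l with
  | nil => exact h
  | @cons u w v hadj p ih =>
    obtain ⟨t, ht⟩ := X.extend_head (u :: l) w
    have := h.extend hX hadj
    rw [ht] at this
    simpa only [CubeComplex.walkExtend, ht] using ih this

/-- Normal forms: every vertex `v` is the end of a reduced path `v :: N v` from `b`, following an
edge extends the reduced path, and `N v` has length `dist b v`. -/
theorem IsCAT0.exists_normalForm (hX : X.IsCAT0) (b : V) :
    ∃ N : V → List V, (∀ u v, X.graph.Adj u v → X.SqEquiv (X.extend (u :: N u) v) (v :: N v)) ∧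
      ∀ v, (N v).length = X.graph.dist b v := by
  have hf := hX.2
  have hN : ∀ v, ∃ t, X.walkExtend [b] (hX.1.1.preconnected b v).some = v :: t ∧
      X.Reduced (v :: t) := fun v => (reduced_singleton b).walkExtend hf _
  choose N hN hr using hN
  have hpath : ∀ v, X.IsPathFrom b (v :: N v) := fun v => by
    rw [← hN]
    exact IsPathFrom.base.walkExtend hf _
  have hwalk : ∀ {v} (p : X.graph.Walk b v), X.SqEquiv (X.walkExtend [b] p) (v :: N v) :=
      fun p => by
    rw [← hN]
    exact hX.1.walkExtend_equiv hf _ _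
  have hadj : ∀ u v, X.graph.Adj u v → X.SqEquiv (X.extend (u :: N u) v) (v :: N v) := by
    intro u v h
    have := hwalk ((hX.1.1.preconnected b u).some.append (.cons h .nil))
    rwa [walkExtend_append, hN] at this
  refine ⟨N, hadj, ?_⟩
  have hlip : ∀ u v, X.graph.Adj u v → (N v).length ≤ (N u).length + 1 := by
    intro u v h
    have h1 := (hadj u v h).length_eq
    by_cases hq : ∃ q, X.SqEquiv (u :: N u) (u :: v :: q)
    · obtain ⟨q, hq⟩ := hq
      have h2 := (extend_of_exists hf hq).length_eq
      have h3 := hq.length_eq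
      simp at h1 h2 h3
      omega
    · rw [extend_of_not_exists hq] at h1
      simp at h1
      omega
  have hb : N b = [] := by
    have := (hwalk (SimpleGraph.Walk.nil : X.graph.Walk b b)).length_eq
    simpa [walkExtend] using this
  have hle : ∀ {u v} (p : X.graph.Walk u v), (N v).length ≤ (N u).length + p.length := by
    intro u v p
    induction p with
    | nil => simp
    | cons h p ih =>
      have := hlip _ _ h
      simp
      omega
  have hge : ∀ n v, (N v).length = n → X.graph.dist b v ≤ n := by
    intro n
    induction n with
    | zero =>
      intro v hv
      have := hpath v
      rw [List.length_eq_zero_iff.1 hv] at this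
      cases this
      simp
    | succ n ih =>
      intro v hv
      have hp := hpath v
      cases hq : N v with
      | nil => simp [hq] at hv
      | cons u q =>
        rw [hq] at hp
        cases hp with
        | cons hp huv =>
          have h1 := hadj v u huv.symm
          have h2 := extend_of_exists hf
            (show X.SqEquiv (v :: N v) (v :: u :: q) by rw [hq]; exact .refl _)
          have h3 := (h2.symm.trans h1).length_eq
          have h4 := ih u (by rw [hq] at hv; simp at h3 hv; omega)
          have := hX.1.1.dist_triangle (u := b) (v := u) (w := v)
          rw [SimpleGraph.dist_eq_one_iff_adj.2 huv] at this
          omega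
  intro v
  refine le_antisymm ?_ (hge _ _ rfl)
  obtain ⟨p, hp⟩ := hX.1.1.exists_walk_length_eq_dist b v
  have := hle p
  rw [hb] at this
  simpa [hp] using this

/-- The `1`-skeleton is bipartite: the distances to the ends of an edge differ by one. -/
theorem IsCAT0.dist_adj (hX : X.IsCAT0) (b : V) {u v : V} (h : X.graph.Adj u v) :
    X.graph.dist b v = X.graph.dist b u + 1 ∨ X.graph.dist b u = X.graph.dist b v + 1 := by
  obtain ⟨N, hN, hl⟩ := hX.exists_normalForm b
  rw [← hl, ← hl]
  have h1 := (hN u v h).length_eq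
  by_cases hq : ∃ q, X.SqEquiv (u :: N u) (u :: v :: q)
  · obtain ⟨q, hq⟩ := hq
    have h2 := (extend_of_exists hX.2 hq).length_eq
    have h3 := hq.length_eq
    simp at h1 h2 h3
    omega
  · rw [extend_of_not_exists hq] at h1
    simp at h1
    omega

/-- The quadrangle condition: two edges at `v` pointing towards `b` span a square whose fourth
vertex is nearer to `b` still. -/
theorem IsCAT0.quadrangle (hX : X.IsCAT0) {b u u' v : V} (h : X.graph.Adj u v)
    (h' : X.graph.Adj u' v) (hne : u ≠ u') (hu : X.graph.dist b v = X.graph.dist b u + 1)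
    (hu' : X.graph.dist b v = X.graph.dist b u' + 1) :
    ∃ w, X.Sq w u v u' ∧ X.graph.dist b u = X.graph.dist b w + 1 := by
  obtain ⟨N, hN, hl⟩ := hX.exists_normalForm b
  have key : ∀ {x y}, X.graph.Adj x y → X.graph.dist b y = X.graph.dist b x + 1 →
      X.SqEquiv (y :: x :: N x) (y :: N y) := by
    intro x y hxy hd
    have h1 := hN x y hxy
    by_cases hq : ∃ q, X.SqEquiv (x :: N x) (x :: y :: q)
    · obtain ⟨q, hq⟩ := hq
      have h2 := (extend_of_exists hX.2 hq).length_eq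
      have h3 := hq.length_eq
      have h4 := h1.length_eq
      rw [← hl, ← hl] at hd
      simp at h2 h3 h4
      omega
    · rwa [extend_of_not_exists hq] at h1
  obtain ⟨w, t, hsq, h1, -⟩ := ((key h hu).trans (key h' hu').symm).exists_sq hX.2 hne
  refine ⟨w, hsq, ?_⟩
  have h2 := extend_of_exists hX.2 h1
  have h3 := ((hN u w hsq.adj₁.symm).symm.trans h2).length_eq
  have h4 := h1.length_eq
  rw [← hl, ← hl]
  simp at h3 h4
  omega

end CubeComplex

/-! ### Halfspaces -/

namespace CubeComplex

variable {V : Type*} {X : CubeComplex V}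

variable (X) in
/-- The side of `a` of the edge `ab`: the vertices nearer to `a` than to `b`. -/
def side (a b : V) : Set V := {v | X.graph.dist v a < X.graph.dist v b}

variable (X) in
/-- The vertex sets of the halfspaces. -/
def IsSide (S : Set V) : Prop := ∃ a b, X.graph.Adj a b ∧ S = X.side a b

lemma IsCAT0.dist_adj_left (hX : X.IsCAT0) (b : V) {u v : V} (h : X.graph.Adj u v) :
    X.graph.dist v b = X.graph.dist u b + 1 ∨ X.graph.dist u b = X.graph.dist v b + 1 := by
  simpa only [SimpleGraph.dist_comm (v := b)] using hX.dist_adj b h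

lemma IsCAT0.mem_side_iff (hX : X.IsCAT0) {a b v : V} (h : X.graph.Adj a b) :
    v ∈ X.side a b ↔ X.graph.dist v b = X.graph.dist v a + 1 := by
  have := hX.dist_adj v h
  simp only [side, Set.mem_ofPred_eq]
  omega

lemma IsCAT0.notMem_side_iff (hX : X.IsCAT0) {a b v : V} (h : X.graph.Adj a b) :
    v ∉ X.side a b ↔ v ∈ X.side b a := by
  have := hX.dist_adj v h
  simp only [side, Set.mem_ofPred_eq]
  omega

lemma IsCAT0.compl_side (hX : X.IsCAT0) {a b : V} (h : X.graph.Adj a b) :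
    (X.side a b)ᶜ = X.side b a := by
  ext v
  exact hX.notMem_side_iff h

lemma left_mem_side {a b : V} (h : X.graph.Adj a b) : a ∈ X.side a b := by
  simp [side, SimpleGraph.dist_eq_one_iff_adj.2 h]

lemma right_notMem_side {a b : V} : b ∉ X.side a b := by
  simp [side]

lemma IsCAT0.side_subset_of_sq (hX : X.IsCAT0) {a b c e : V} (h : X.Sq a b c e) :
    X.side a b ⊆ X.side e c := by
  intro v hv
  rw [hX.mem_side_iff h.adj₁] at hv
  by_contra hn
  rw [hX.notMem_side_iff h.adj₃.symm, hX.mem_side_iff h.adj₃] at hn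
  have h1 := hX.dist_adj v h.adj₂
  have h2 := hX.dist_adj v h.adj₄
  obtain ⟨w, hw, hd⟩ := hX.quadrangle (b := v) h.adj₁ h.adj₂.symm h.1 (by omega) (by omega)
  obtain rfl : w = e := hw.rotate.unique_adjacent h
  omega

lemma IsCAT0.side_eq_of_sq (hX : X.IsCAT0) {a b c e : V} (h : X.Sq a b c e) :
    X.side a b = X.side e c :=
  (hX.side_subset_of_sq h).antisymm (hX.side_subset_of_sq h.reflect.rotate)

/-- Induction over the edges across the partition of the vertices defined by the edge `ab`: each of
them is joined to `ab` by a ladder of squares. -/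
lemma IsCAT0.crossing_induction (hX : X.IsCAT0) {a b : V} (hab : X.graph.Adj a b)
    {P : V → V → Prop} (base : P a b)
    (step : ∀ u v w u', X.Sq w v u u' → u ∈ X.side a b → v ∉ X.side a b → u' ∈ X.side a b →
      w ∉ X.side a b → P u' w → P u v) {u v : V}
    (huv : X.graph.Adj u v) (hu : u ∈ X.side a b) (hv : v ∉ X.side a b) : P u v := by
  induction hn : X.graph.dist a u generalizing u v with
  | zero =>
    obtain rfl := (hX.1.1.dist_eq_zero_iff).1 hn
    rw [hX.notMem_side_iff hab, hX.mem_side_iff hab.symm] at hv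
    obtain rfl : v = b := by
      have h1 : X.graph.dist v a = 1 := SimpleGraph.dist_eq_one_iff_adj.2 huv.symm
      exact (hX.1.1.dist_eq_zero_iff).1 (by omega)
    exact base
  | succ n ih =>
    have hu₀ := hu
    have hv₀ := hv
    rw [hX.notMem_side_iff hab, hX.mem_side_iff hab.symm] at hv
    rw [hX.mem_side_iff hab] at hu
    have ha := hX.dist_adj_left a huv
    have hb := hX.dist_adj_left b huv
    obtain ⟨p, hp⟩ := hX.1.1.exists_walk_length_eq_dist u a
    rw [SimpleGraph.dist_comm] at hn
    cases p with
    | nil => simp at hn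
    | @cons _ u' _ huu' p =>
      have hle := SimpleGraph.dist_le p
      simp only [SimpleGraph.Walk.length_cons] at hp
      have ha' := hX.dist_adj_left a huu'
      have hb' := hX.dist_adj_left b huu'
      have hab' := hX.dist_adj u' hab
      have hne : v ≠ u' := by rintro rfl; omega
      -- towards `b`, the vertex `u` has the two neighbours `v` and `u'`
      obtain ⟨w, hw, hd⟩ := hX.quadrangle (b := b) huv.symm huu'.symm hne
        (by simp only [SimpleGraph.dist_comm (u := b)]; omega)
        (by simp only [SimpleGraph.dist_comm (u := b)]; omega)
      simp only [SimpleGraph.dist_comm (u := b)] at hd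
      have hwa := hX.dist_adj_left a hw.adj₁
      have hwa' := hX.dist_adj_left a hw.adj₄
      have hwb := hX.dist_adj w hab
      have hu' : u' ∈ X.side a b := (hX.mem_side_iff hab).2 (by omega)
      have hw' : w ∉ X.side a b := fun h => by rw [hX.mem_side_iff hab] at h; omega
      exact step u v w u' hw hu₀ hv₀ hu' hw'
        (ih hw.adj₄ hu' hw' (by rw [SimpleGraph.dist_comm]; omega))

/-- The edges across the partition of the vertices defined by the edge `ab` are those dual to the
hyperplane of `ab`. -/
lemma IsCAT0.opposite_of_crossing (hX : X.IsCAT0) {a b u v : V} (hab : X.graph.Adj a b)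
    (huv : X.graph.Adj u v) (hu : u ∈ X.side a b) (hv : v ∉ X.side a b) :
    Relation.EqvGen X.Opposite s(a, b) s(u, v) ∧ X.side u v = X.side a b := by
  refine hX.crossing_induction hab
    (P := fun u v => Relation.EqvGen X.Opposite s(a, b) s(u, v) ∧ X.side u v = X.side a b)
    ⟨.refl _, rfl⟩ ?_ huv hu hv
  rintro u v w u' hw - - - - ⟨h1, h2⟩
  refine ⟨h1.trans _ _ _ (.rel _ _ ?_), ?_⟩
  · have := hw.rotate.rotate.rotate.opposite
    rwa [Sym2.eq_swap (a := u) (b := v)]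
  · rw [← h2]
    exact hX.side_eq_of_sq hw.reflect.rotate.rotate

lemma IsCAT0.side_eq_of_crossing (hX : X.IsCAT0) {S : Set V} (hS : X.IsSide S) {u v : V}
    (huv : X.graph.Adj u v) (hu : u ∈ S) (hv : v ∉ S) : S = X.side u v := by
  obtain ⟨a, b, hab, rfl⟩ := hS
  exact (hX.opposite_of_crossing hab huv hu hv).2.symm

lemma IsCAT0.eqvGen_opposite_iff (hX : X.IsCAT0) {a b u v : V} (hab : X.graph.Adj a b) :
    Relation.EqvGen X.Opposite s(a, b) s(u, v) ↔
      X.graph.Adj u v ∧ (u ∈ X.side a b ↔ v ∉ X.side a b) := by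
  constructor
  · have key : ∀ e f, Relation.EqvGen X.Opposite e f → (e ∈ X.graph.edgeSet ↔ f ∈ X.graph.edgeSet) ∧
        ∀ a b u v, e = s(a, b) → f = s(u, v) → X.graph.Adj a b →
          X.side a b = X.side u v ∨ X.side a b = X.side v u := by
      intro e f h
      induction h with
      | rel e f h =>
        refine ⟨⟨fun _ => h.2.1, fun _ => h.1⟩, ?_⟩
        rintro a b u v rfl rfl _
        rcases h.sq with h | h
        · exact .inr (hX.side_eq_of_sq h)
        · exact .inl (hX.side_eq_of_sq h)
      | refl e =>
        refine ⟨Iff.rfl, ?_⟩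
        rintro a b u v rfl h _
        rcases Sym2.eq_iff.1 h with ⟨rfl, rfl⟩ | ⟨rfl, rfl⟩
        · exact .inl rfl
        · exact .inr rfl
      | symm e f _ ih =>
        refine ⟨ih.1.symm, ?_⟩
        rintro a b u v rfl rfl hab
        have huv : X.graph.Adj u v := ih.1.2 hab
        rcases ih.2 u v a b rfl rfl huv with h | h
        · exact .inl h.symm
        · right
          rw [← hX.compl_side huv, h, hX.compl_side hab.symm]
      | trans e f g _ _ ih ih' =>
        refine ⟨ih.1.trans ih'.1, ?_⟩
        rintro a b u v rfl rfl hab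
        induction f with
        | _ c d =>
          have hcd : X.graph.Adj c d := ih.1.1 hab
          have huv : X.graph.Adj u v := ih'.1.1 hcd
          rcases ih.2 a b c d rfl rfl hab with h | h <;>
            rcases ih'.2 c d u v rfl rfl hcd with h' | h'
          · exact .inl (h.trans h')
          · exact .inr (h.trans h')
          · right
            rw [h, ← hX.compl_side hcd, h', hX.compl_side huv]
          · left
            rw [h, ← hX.compl_side hcd, h', hX.compl_side huv.symm]
    intro h
    have huv : X.graph.Adj u v := (key _ _ h).1.1 hab
    refine ⟨huv, ?_⟩
    rcases (key _ _ h).2 a b u v rfl rfl hab with h | h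
    · simp [h, left_mem_side huv, right_notMem_side]
    · simp [h, left_mem_side huv.symm, right_notMem_side]
  · rintro ⟨huv, h⟩
    by_cases hu : u ∈ X.side a b
    · exact (hX.opposite_of_crossing hab huv hu (h.1 hu)).1
    · have hv : v ∈ X.side a b := by tauto
      rw [Sym2.eq_swap (a := u)]
      exact (hX.opposite_of_crossing hab huv.symm hv hu).1

lemma IsCAT0.isSide_compl (hX : X.IsCAT0) {S : Set V} (hS : X.IsSide S) : X.IsSide Sᶜ := by
  obtain ⟨a, b, hab, rfl⟩ := hS
  exact ⟨b, a, hab.symm, hX.compl_side hab⟩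

lemma IsCAT0.reachable_of_mem_side (hX : X.IsCAT0) {a b v : V} (hab : X.graph.Adj a b)
    {H : Set (Sym2 V)} (hH : ∀ u v, s(u, v) ∈ H → (u ∈ X.side a b ↔ v ∉ X.side a b))
    (hv : v ∈ X.side a b) : (X.graph.deleteEdges H).Reachable v a := by
  obtain ⟨p, hp⟩ := hX.1.1.exists_walk_length_eq_dist v a
  generalize hc : a = c at p hp
  induction p with
  | nil => exact .refl _
  | cons h p ih =>
    subst hc
    have h1 := hX.dist_adj_left a h
    have h2 := hX.dist_adj_left b h
    have h3 := SimpleGraph.dist_le p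
    rw [hX.mem_side_iff hab] at hv
    simp only [SimpleGraph.Walk.length_cons] at hp
    rename_i u w
    have hw : w ∈ X.side a b := by
      have := hX.dist_adj w hab
      rw [hX.mem_side_iff hab]
      omega
    refine SimpleGraph.Reachable.trans (SimpleGraph.Adj.reachable ?_) (ih hw rfl (by omega))
    rw [SimpleGraph.deleteEdges_adj]
    refine ⟨h, fun hmem => ?_⟩
    exact (hH _ _ hmem).1 ((hX.mem_side_iff hab).2 hv) hw

lemma IsCAT0.supp_eq_side (hX : X.IsCAT0) {a b v : V} (hab : X.graph.Adj a b)
    {H : Set (Sym2 V)} (hH : ∀ u v, X.graph.Adj u v →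
      (s(u, v) ∈ H ↔ (u ∈ X.side a b ↔ v ∉ X.side a b)))
    (hH' : ∀ u v, s(u, v) ∈ H → X.graph.Adj u v) (hv : v ∈ X.side a b) :
    ((X.graph.deleteEdges H).connectedComponentMk v).supp = X.side a b := by
  have hH'' := fun u v h => (hH u v (hH' u v h)).1 h
  ext w
  rw [SimpleGraph.ConnectedComponent.mem_supp_iff, SimpleGraph.ConnectedComponent.eq]
  constructor
  · rintro ⟨p⟩
    induction p with
    | nil => exact hv
    | cons h p ih =>
      rw [SimpleGraph.deleteEdges_adj, hH _ _ h.1] at h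
      have := ih hv
      tauto
  · intro hw
    exact (hX.reachable_of_mem_side hab hH'' hw).trans
      (hX.reachable_of_mem_side hab hH'' hv).symm

/-- A halfspace is one side of an edge, and its bounding hyperplane consists of the edges leaving
that side. -/
lemma IsCAT0.exists_side (hX : X.IsCAT0) (h : X.Halfspace) :
    X.IsSide h.carrier ∧ ∀ u v, s(u, v) ∈ h.hyperplane ↔
      X.graph.Adj u v ∧ (u ∈ h.carrier ↔ v ∉ h.carrier) := by
  obtain ⟨H, S, ⟨e, he, rfl⟩, c, rfl⟩ := h
  induction e with
  | _ a b =>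
  have hab : X.graph.Adj a b := he
  have key : ∀ u v, s(u, v) ∈ {f | Relation.EqvGen X.Opposite s(a, b) f} ↔
      X.graph.Adj u v ∧ (u ∈ X.side a b ↔ v ∉ X.side a b) :=
    fun u v => hX.eqvGen_opposite_iff hab
  have key' : ∀ u v, s(u, v) ∈ {f | Relation.EqvGen X.Opposite s(a, b) f} ↔
      X.graph.Adj u v ∧ (u ∈ X.side b a ↔ v ∉ X.side b a) := fun u v => by
    rw [key, ← hX.notMem_side_iff hab, ← hX.notMem_side_iff hab]
    tauto
  obtain ⟨v, rfl⟩ := c.exists_rep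
  simp only
  by_cases hv : v ∈ X.side a b
  · have := hX.supp_eq_side hab (fun u v h => by rw [key]; tauto)
      (fun u v h => ((key u v).1 h).1) hv
    erw [this]
    exact ⟨⟨a, b, hab, rfl⟩, key⟩
  · rw [hX.notMem_side_iff hab] at hv
    have := hX.supp_eq_side hab.symm (fun u v h => by rw [key']; tauto)
      (fun u v h => ((key' u v).1 h).1) hv
    erw [this]
    exact ⟨⟨b, a, hab.symm, rfl⟩, key'⟩

lemma IsCAT0.exists_halfspace (hX : X.IsCAT0) {S : Set V} (hS : X.IsSide S) :
    ∃ h : X.Halfspace, h.carrier = S := by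
  obtain ⟨a, b, hab, rfl⟩ := hS
  have key : ∀ u v, s(u, v) ∈ {f | Relation.EqvGen X.Opposite s(a, b) f} ↔
      X.graph.Adj u v ∧ (u ∈ X.side a b ↔ v ∉ X.side a b) :=
    fun u v => hX.eqvGen_opposite_iff hab
  refine ⟨⟨{f | Relation.EqvGen X.Opposite s(a, b) f}, X.side a b, ⟨_, hab, rfl⟩, ?_⟩, rfl⟩
  exact ⟨_, (hX.supp_eq_side hab (fun u v h => by rw [key]; tauto)
    (fun u v h => ((key u v).1 h).1) (left_mem_side hab)).symm⟩

end CubeComplex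

/-! ### Convexity, separating halfspaces and gates -/

namespace CubeComplex

variable {V : Type*} {X : CubeComplex V}

lemma IsCAT0.exists_toward (hX : X.IsCAT0) {u v : V} (h : u ≠ v) :
    ∃ u', X.graph.Adj u u' ∧ X.graph.dist u v = X.graph.dist u' v + 1 := by
  obtain ⟨p, hp⟩ := hX.1.1.exists_walk_length_eq_dist u v
  cases p with
  | nil => exact absurd rfl h
  | @cons _ u' _ huu' p =>
    have h1 := SimpleGraph.dist_le p
    have h2 := hX.dist_adj_left v huu'
    simp only [SimpleGraph.Walk.length_cons] at hp
    exact ⟨u', huu', by omega⟩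

lemma mem_interval {x y v : V} :
    v ∈ X.interval x y ↔ X.graph.dist x y = X.graph.dist x v + X.graph.dist v y := Iff.rfl

lemma left_mem_interval (x y : V) : x ∈ X.interval x y := by simp [mem_interval]

lemma right_mem_interval (x y : V) : y ∈ X.interval x y := by simp [mem_interval]

variable (X) in
/-- A set of vertices is convex if it contains the interval between any two of its points. -/
def IsConvex (C : Set V) : Prop := ∀ u ∈ C, ∀ v ∈ C, X.interval u v ⊆ C

theorem IsCAT0.isConvex_side (hX : X.IsCAT0) {S : Set V} (hS : X.IsSide S) : X.IsConvex S := by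
  intro u hu v hv x hx
  induction hn : X.graph.dist u x generalizing u with
  | zero => rwa [← (hX.1.1.dist_eq_zero_iff).1 hn]
  | succ n ih =>
    have hne : u ≠ x := by rintro rfl; simp at hn
    obtain ⟨u', huu', hd⟩ := hX.exists_toward hne
    rw [mem_interval] at hx
    have ht := hX.1.1.dist_triangle (u := u') (v := x) (w := v)
    have ha := hX.dist_adj_left v huu'
    by_cases hu' : u' ∈ S
    · exact ih u' hu' (mem_interval.2 (by omega)) (by omega)
    · have := hX.side_eq_of_crossing hS huu' hu hu'
      rw [this, hX.mem_side_iff huu', SimpleGraph.dist_comm, SimpleGraph.dist_comm (v := u)] at hv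
      omega

variable (X) in
/-- The sides separating `u` from `v`, with `v` on them and `u` off them. -/
def sepSides (u v : V) : Set (Set V) := {S | X.IsSide S ∧ u ∉ S ∧ v ∈ S}

/-- The distance is the number of separating halfspaces. -/
theorem IsCAT0.encard_sepSides (hX : X.IsCAT0) (u v : V) :
    (X.sepSides u v).encard = X.graph.dist u v := by
  induction hn : X.graph.dist u v generalizing u with
  | zero =>
    obtain rfl := (hX.1.1.dist_eq_zero_iff).1 hn
    simp only [Nat.cast_zero, Set.encard_eq_zero]
    ext S
    simp only [sepSides, Set.mem_ofPred_eq, Set.mem_empty_iff_false]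
    tauto
  | succ n ih =>
    have hne : u ≠ v := by rintro rfl; simp at hn
    obtain ⟨u', huu', hd⟩ := hX.exists_toward hne
    have hins : X.sepSides u v = insert (X.side u' u) (X.sepSides u' v) := by
      have hv : v ∈ X.side u' u := by
        rw [hX.mem_side_iff huu'.symm, SimpleGraph.dist_comm, SimpleGraph.dist_comm (v := u')]
        exact hd
      ext S
      constructor
      · rintro ⟨hS, hu, hv⟩
        by_cases hu' : u' ∈ S
        · exact .inl (hX.side_eq_of_crossing hS huu'.symm hu' hu)
        · exact .inr ⟨hS, hu', hv⟩
      · rintro (rfl | ⟨hS, hu', hv'⟩)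
        · exact ⟨⟨_, _, huu'.symm, rfl⟩, right_notMem_side, hv⟩
        · refine ⟨hS, fun hu => hu' (hX.isConvex_side hS u hu v hv' ?_), hv'⟩
          rw [mem_interval, hd, SimpleGraph.dist_eq_one_iff_adj.2 huu', add_comm]
    rw [hins, Set.encard_insert_of_notMem fun h => h.2.1 (left_mem_side huu'.symm),
      ih u' (by omega)]
    simp

lemma IsCAT0.finite_sepSides (hX : X.IsCAT0) (u v : V) : (X.sepSides u v).Finite :=
  Set.finite_of_encard_eq_coe (hX.encard_sepSides u v)

lemma IsCAT0.ncard_sepSides (hX : X.IsCAT0) (u v : V) :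
    (X.sepSides u v).ncard = X.graph.dist u v := by
  rw [Set.ncard, hX.encard_sepSides]
  rfl

/-- An interval is the intersection of the halfspaces containing its two ends. -/
lemma IsCAT0.mem_interval_iff (hX : X.IsCAT0) {u v x : V} :
    x ∈ X.interval u v ↔ ∀ S, X.IsSide S → u ∈ S → v ∈ S → x ∈ S := by
  refine ⟨fun h S hS hu hv => hX.isConvex_side hS u hu v hv h, fun h => ?_⟩
  have h1 : X.sepSides u x ∪ X.sepSides x v ⊆ X.sepSides u v := by
    rintro S (⟨hS, hu, hx⟩ | ⟨hS, hx, hv⟩)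
    · refine ⟨hS, hu, ?_⟩
      by_contra hv
      exact h _ (hX.isSide_compl hS) hu hv hx
    · exact ⟨hS, fun hu => hx (h S hS hu hv), hv⟩
  have hdisj : Disjoint (X.sepSides u x) (X.sepSides x v) :=
    Set.disjoint_left.2 fun S h h' => h'.2.1 h.2.2
  have h2 := Set.encard_le_encard h1
  rw [Set.encard_union_eq hdisj, hX.encard_sepSides, hX.encard_sepSides, hX.encard_sepSides] at h2
  have h3 := hX.1.1.dist_triangle (u := u) (v := x) (w := v)
  exact mem_interval.2 (le_antisymm h3 (by exact_mod_cast h2))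

lemma IsCAT0.isConvex_interval (hX : X.IsCAT0) (x y : V) : X.IsConvex (X.interval x y) := by
  intro u hu v hv w hw
  rw [hX.mem_interval_iff] at hu hv hw ⊢
  exact fun S hS hx hy => hw S hS (hu S hS hx hy) (hv S hS hx hy)

variable (X) in
/-- `g` is the gate of `p` in `C`: a point of `C` through which `p` is joined by a geodesic to every
point of `C`. -/
def IsGate (C : Set V) (p g : V) : Prop := g ∈ C ∧ ∀ x ∈ C, g ∈ X.interval p x

/-- Nearest points in convex sets are gates. -/
theorem IsCAT0.isGate_of_nearest (hX : X.IsCAT0) {C : Set V} (hC : X.IsConvex C) {p g : V}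
    (hg : g ∈ C) (hmin : ∀ x ∈ C, X.graph.dist p g ≤ X.graph.dist p x) : X.IsGate C p g := by
  refine ⟨hg, fun x hx => ?_⟩
  induction hn : X.graph.dist x g using Nat.strong_induction_on generalizing x with
  | _ n ih =>
  rw [mem_interval, SimpleGraph.dist_comm (u := g)]
  rcases eq_or_ne x g with rfl | hne
  · simp
  -- `x'` and then `x₂` follow `x` on a geodesic to `g`
  obtain ⟨x', hxx', hd⟩ := hX.exists_toward hne
  have h1 : X.graph.dist x x' = 1 := SimpleGraph.dist_eq_one_iff_adj.2 hxx'
  have hx' : x' ∈ C := hC x hx g hg (mem_interval.2 (by omega))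
  have ih' := ih _ (by omega) x' hx' rfl
  rw [mem_interval, SimpleGraph.dist_comm (u := g)] at ih'
  have hadj := hX.dist_adj p hxx'
  have hm := hmin x hx
  by_contra hcon
  have hne' : x' ≠ g := by rintro rfl; simp at ih' hd; omega
  obtain ⟨x₂, hxx₂, hd₂⟩ := hX.exists_toward hne'
  have h2 : X.graph.dist x' x₂ = 1 := SimpleGraph.dist_eq_one_iff_adj.2 hxx₂
  have hx₂ : x₂ ∈ C := hC x' hx' g hg (mem_interval.2 (by omega))
  have ih₂ := ih _ (by omega) x₂ hx₂ rfl
  rw [mem_interval, SimpleGraph.dist_comm (u := g)] at ih₂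
  have hne₂ : x ≠ x₂ := by rintro rfl; omega
  obtain ⟨w, hw, hwd⟩ := hX.quadrangle (b := p) hxx' hxx₂.symm hne₂ (by omega) (by omega)
  have hw1 : X.graph.dist x w = 1 := SimpleGraph.dist_eq_one_iff_adj.2 hw.adj₁.symm
  have hw2 : X.graph.dist w x₂ = 1 := SimpleGraph.dist_eq_one_iff_adj.2 hw.adj₄.symm
  have ht := hX.1.1.dist_triangle (u := x) (v := x₂) (w := g)
  have ht' := hX.1.1.dist_triangle (u := x) (v := w) (w := x₂)
  have hwC : w ∈ C := hC x hx x₂ hx₂ (mem_interval.2 (by omega))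
  have hwg := hX.dist_adj_left g hw.adj₄
  have hwg' := hX.dist_adj_left g hw.adj₁
  have ihw := ih _ (by omega) w hwC rfl
  rw [mem_interval, SimpleGraph.dist_comm (u := g)] at ihw
  omega

lemma exists_nearest {C : Set V} (hC : C.Nonempty) (p : V) :
    ∃ g ∈ C, ∀ x ∈ C, X.graph.dist p g ≤ X.graph.dist p x := by
  obtain ⟨g, hg, hmin⟩ := (measure fun x => X.graph.dist p x).wf.has_min C hC
  exact ⟨g, hg, fun x hx => not_lt.1 (hmin x hx)⟩

lemma IsCAT0.exists_isGate (hX : X.IsCAT0) {C : Set V} (hC : X.IsConvex C) (hne : C.Nonempty)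
    (p : V) : ∃ g, X.IsGate C p g := by
  obtain ⟨g, hg, hmin⟩ := exists_nearest (X := X) hne p
  exact ⟨g, hX.isGate_of_nearest hC hg hmin⟩

/-- A halfspace containing a point of `C` contains the gate of `p` if it contains `p`. -/
lemma IsGate.mem_of_mem (hX : X.IsCAT0) {C S : Set V} {p g x : V} (h : X.IsGate C p g)
    (hS : X.IsSide S) (hp : p ∈ S) (hx : x ∈ C) (hxS : x ∈ S) : g ∈ S :=
  hX.isConvex_side hS p hp x hxS (h.2 x hx)

lemma IsGate.notMem_of_notMem (hX : X.IsCAT0) {C S : Set V} {p g x : V} (h : X.IsGate C p g)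
    (hS : X.IsSide S) (hp : p ∉ S) (hx : x ∈ C) (hxS : x ∉ S) : g ∉ S :=
  h.mem_of_mem hX (hX.isSide_compl hS) hp hx hxS

lemma IsGate.dist_le {C : Set V} {p g x : V} (h : X.IsGate C p g) (hx : x ∈ C) :
    X.graph.dist p g ≤ X.graph.dist p x := by
  have := mem_interval.1 (h.2 x hx)
  omega

/-- All four intersections of `S`, `T` and their complements are nonempty. -/
def Crosses (S T : Set V) : Prop :=
  (S ∩ T).Nonempty ∧ (S ∩ Tᶜ).Nonempty ∧ (Sᶜ ∩ T).Nonempty ∧ (Sᶜ ∩ Tᶜ).Nonempty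

/-- Between a point off `T` and a point on `T` of a convex set `C` there is an edge in `C` leading
into `T`. -/
lemma IsCAT0.exists_crossing_edge (hX : X.IsCAT0) {C T : Set V} (hC : X.IsConvex C) {u v : V}
    (hu : u ∈ C) (hv : v ∈ C) (huT : u ∉ T) (hvT : v ∈ T) :
    ∃ a b, X.graph.Adj a b ∧ a ∈ C ∧ b ∈ C ∧ a ∉ T ∧ b ∈ T := by
  induction hn : X.graph.dist u v generalizing u with
  | zero =>
    obtain rfl := (hX.1.1.dist_eq_zero_iff).1 hn
    exact absurd hvT huT
  | succ n ih =>
    have hne : u ≠ v := by rintro rfl; exact huT hvT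
    obtain ⟨u', huu', hd⟩ := hX.exists_toward hne
    have h1 : X.graph.dist u u' = 1 := SimpleGraph.dist_eq_one_iff_adj.2 huu'
    have hu' : u' ∈ C := hC u hu v hv (mem_interval.2 (by omega))
    by_cases h : u' ∈ T
    · exact ⟨u, u', huu', hu, hu', huT, h⟩
    · exact ih hu' h (by omega)

/-- Two hyperplanes are transverse exactly when their halfspaces cross. -/
theorem IsCAT0.transverse_iff (hX : X.IsCAT0) (h k : X.Halfspace) :
    X.Transverse h.hyperplane k.hyperplane ↔ Crosses h.carrier k.carrier := by
  obtain ⟨hh, hhe⟩ := hX.exists_side h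
  obtain ⟨hk, hke⟩ := hX.exists_side k
  generalize h.carrier = S at *
  generalize k.carrier = T at *
  generalize h.hyperplane = H at *
  generalize k.hyperplane = K at *
  constructor
  · rintro ⟨C, a, b, c, hC, ha, hb, hc, hbc, hab, hac, habH, hacK⟩
    obtain ⟨e, hsq, -⟩ := hC.exists_sq ha hb hc hbc hab hac
    have h1 := ((hhe a b).1 habH).2
    have h2 := ((hke a c).1 hacK).2
    -- a halfspace containing one end of `ab` contains exactly two vertices of the square
    have key : ∀ {a b c e : V} {S : Set V}, X.IsSide S → X.Sq a b e c → (a ∈ S ↔ b ∉ S) →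
        (c ∈ S ↔ a ∈ S) ∧ (e ∈ S ↔ b ∈ S) := by
      intro a b c e S hS hsq h1
      have hcab : c ∈ X.side a b := by
        have h1 : X.graph.dist c a = 1 := SimpleGraph.dist_eq_one_iff_adj.2 hsq.adj₄
        have := hX.dist_adj c hsq.adj₁
        have h2 : X.graph.dist c b ≠ 0 := fun h => hsq.2.1 ((hX.1.1.dist_eq_zero_iff).1 h).symm
        rw [hX.mem_side_iff hsq.adj₁]
        omega
      have heab : e ∉ X.side a b := by
        have h1 : X.graph.dist e b = 1 := SimpleGraph.dist_eq_one_iff_adj.2 hsq.adj₂.symm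
        have := hX.dist_adj e hsq.adj₁
        have h2 : X.graph.dist e a ≠ 0 := fun h => hsq.1 ((hX.1.1.dist_eq_zero_iff).1 h).symm
        rw [hX.mem_side_iff hsq.adj₁]
        omega
      by_cases ha : a ∈ S
      · obtain rfl := hX.side_eq_of_crossing hS hsq.adj₁ ha (h1.1 ha)
        simp [hcab, heab, ha, h1.1 ha]
      · have hb : b ∈ S := by tauto
        obtain rfl := hX.side_eq_of_crossing hS hsq.adj₁.symm hb ha
        rw [hX.notMem_side_iff hsq.adj₁] at heab
        rw [← hX.notMem_side_iff hsq.adj₁.symm] at hcab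
        simp [hcab, heab, ha, hb]
    have k1 := key hh hsq h1
    have k2 := key hk hsq.reflect h2
    by_cases haS : a ∈ S <;> by_cases haT : a ∈ T
    · exact ⟨⟨a, by tauto⟩, ⟨c, by simp; tauto⟩, ⟨b, by simp; tauto⟩, ⟨e, by simp; tauto⟩⟩
    · exact ⟨⟨c, by simp; tauto⟩, ⟨a, by simp; tauto⟩, ⟨e, by simp; tauto⟩, ⟨b, by simp; tauto⟩⟩
    · exact ⟨⟨b, by simp; tauto⟩, ⟨e, by simp; tauto⟩, ⟨a, by simp; tauto⟩, ⟨c, by simp; tauto⟩⟩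
    · exact ⟨⟨e, by simp; tauto⟩, ⟨b, by simp; tauto⟩, ⟨c, by simp; tauto⟩, ⟨a, by simp; tauto⟩⟩
  · rintro ⟨⟨p, hpS, hpT⟩, ⟨q, hqS, hqT⟩, ⟨r, hrS, hrT⟩, ⟨s, hsS, hsT⟩⟩
    obtain ⟨a, b, hab, haS, hbS, haT, hbT⟩ :=
      hX.exists_crossing_edge (hX.isConvex_side hh) hqS hpS hqT hpT
    obtain ⟨a', b', hab', haS', hbS', haT', hbT'⟩ :=
      hX.exists_crossing_edge (hX.isConvex_side (hX.isSide_compl hh)) hsS hrS hsT hrT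
    have hT := hX.side_eq_of_crossing hk hab.symm hbT haT
    by_contra hnt
    have := hX.crossing_induction hab.symm (P := fun u v => u ∈ S ∧ v ∈ S) ⟨hbS, haS⟩ ?_ hab'.symm
      (hT ▸ hbT') (hT ▸ haT')
    · exact hbS' this.1
    rw [← hT]
    rintro u v w u' hsq hu hv hu' hw ⟨hu'S, hwS⟩
    by_contra hcon
    -- the first rung of the ladder leaving `S` bounds a square crossed by both hyperplanes
    apply hnt
    have hmem : ∀ {p q}, X.graph.Adj p q → p ∈ S → q ∉ S → s(p, q) ∈ H :=
      fun h h1 h2 => (hhe _ _).2 ⟨h, by tauto⟩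
    by_cases huS : u ∈ S
    · have hvS : v ∉ S := fun h => hcon ⟨huS, h⟩
      exact ⟨_, w, v, u', hsq.isCube, by simp, by simp, by simp, hsq.2.1, hsq.adj₁, hsq.adj₄.symm,
        hmem hsq.adj₁ hwS hvS, (hke _ _).2 ⟨hsq.adj₄.symm, by tauto⟩⟩
    · exact ⟨_, u', u, w, hsq.isCube, by simp, by simp, by simp, hsq.1.symm, hsq.adj₃.symm,
        hsq.adj₄,
        hmem hsq.adj₃.symm hu'S huS, (hke _ _).2 ⟨hsq.adj₄, by tauto⟩⟩

end CubeComplex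

/-! ### Antichains, pencils and grids -/

/-- In a finite set of more than `n * w` elements, either some antichain has more than `w` elements
or there is a chain of `n + 1` elements. -/
lemma exists_strictMono_of_antichain_le {α : Type*} [PartialOrder α] {w : ℕ} (n : ℕ)
    {T : Finset α} (hw : ∀ A ⊆ T, IsAntichain (· ≤ ·) (A : Set α) → A.card ≤ w)
    (hT : n * w < T.card) : ∃ f : Fin (n + 1) → α, StrictMono f ∧ ∀ i, f i ∈ T := by
  classical
  induction n generalizing T with
  | zero =>
    obtain ⟨x, hx⟩ := Finset.card_pos.1 (by simpa using hT)
    exact ⟨fun _ => x, fun i j hij => by omega, fun _ => hx⟩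
  | succ n ih =>
    -- remove the minimal elements
    set A := T.filter fun x => Minimal (· ∈ T) x with hA
    have hAT : A ⊆ T := Finset.filter_subset _ _
    have hAw : A.card ≤ w := hw A hAT fun x hx y hy hne hle => by
      simp only [hA, Finset.coe_filter, Set.mem_ofPred_eq] at hx hy
      exact hne (hle.antisymm (hy.2.2 hx.1 hle))
    obtain ⟨f, hf, hfT⟩ := ih (T := T \ A)
      (fun B hB => hw B (hB.trans Finset.sdiff_subset)) (by
        rw [Finset.card_sdiff_of_subset hAT]
        rw [Nat.succ_mul] at hT
        omega)
    have h0 := Finset.mem_sdiff.1 (hfT 0)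
    obtain ⟨y, hyT, hy⟩ : ∃ y ∈ T, y < f 0 := by
      by_contra! hcon
      refine h0.2 (Finset.mem_filter.2 ⟨h0.1, h0.1, fun y hy hle => ?_⟩)
      rcases hle.lt_or_eq with h | h
      · exact absurd h (hcon y hy)
      · exact h.ge
    refine ⟨Fin.cons y f, ?_, ?_⟩
    · rw [Fin.strictMono_iff_lt_succ]
      intro i
      refine Fin.cases ?_ (fun i => ?_) i
      · simpa using hy
      · rw [← Fin.succ_castSucc, Fin.cons_succ, Fin.cons_succ]
        exact hf (Fin.castSucc_lt_succ)
    · intro i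
      refine Fin.cases hyT (fun i => ?_) i
      rw [Fin.cons_succ]
      exact (Finset.mem_sdiff.1 (hfT i)).1

namespace CubeComplex

variable {V : Type*} {X : CubeComplex V}

/-- At most `d` edges at a vertex lead towards a given vertex. -/
lemma IsCAT0.card_toward_le (hX : X.IsCAT0) {d : ℕ} (hd : X.HasDim d) {b v : V} (S : Finset V)
    (hS : ∀ u ∈ S, X.graph.Adj v u ∧ X.graph.dist b v = X.graph.dist b u + 1) : S.card ≤ d := by
  refine hX.2.card_le hd v S (fun u hu => (hS u hu).1) fun u hu w hw hne => ?_
  obtain ⟨e, he, -⟩ := hX.quadrangle (hS u hu).1.symm (hS w hw).1.symm hne (hS u hu).2 (hS w hw).2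
  exact ⟨e, he.rotate.rotate.reflect⟩

/-- Every halfspace separating `a` from `b` lies in one whose hyperplane is dual to an edge at
`a` that leads towards `b`. -/
lemma IsCAT0.exists_subset_side (hX : X.IsCAT0) {a b : V} {S : Set V} (hS : S ∈ X.sepSides a b) :
    ∃ u, X.graph.Adj u a ∧ X.graph.dist b a = X.graph.dist b u + 1 ∧ S ⊆ X.side u a := by
  obtain ⟨hS, ha, hb⟩ := hS
  obtain ⟨g, hg⟩ := hX.exists_isGate (hX.isConvex_side hS) ⟨b, hb⟩ a
  have hne : a ≠ g := by rintro rfl; exact ha hg.1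
  obtain ⟨u, hau, hd⟩ := hX.exists_toward hne
  have key : ∀ x ∈ S, X.graph.dist x a = X.graph.dist x u + 1 := by
    intro x hx
    have h1 := mem_interval.1 (hg.2 x hx)
    have h2 := hX.1.1.dist_triangle (u := u) (v := g) (w := x)
    have h3 := hX.dist_adj x hau
    rw [SimpleGraph.dist_comm (u := x), SimpleGraph.dist_comm (u := x)] at *
    omega
  exact ⟨u, hau.symm, key b hb, fun x hx => (hX.mem_side_iff hau.symm).2 (key x hx)⟩

/-- The width of the set of halfspaces separating two vertices is at most the dimension. Moving `a`
towards `b` across halfspaces outside the antichain, one reaches a vertex at which all hyperplanes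
of the antichain are dual to edges. -/
lemma IsCAT0.card_antichain_le (hX : X.IsCAT0) {d : ℕ} (hd : X.HasDim d) {a b : V}
    {A : Finset (Set V)} (hA : ∀ S ∈ A, S ∈ X.sepSides a b)
    (hanti : IsAntichain (· ≤ ·) (A : Set (Set V))) : A.card ≤ d := by
  classical
  induction hn : X.graph.dist b a generalizing a with
  | zero =>
    obtain rfl := (hX.1.1.dist_eq_zero_iff).1 hn
    have : A = ∅ := by
      refine Finset.eq_empty_of_forall_notMem fun S hS => (hA S hS).2.1 (hA S hS).2.2
    simp [this]
  | succ n ih =>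
    by_cases hmove : ∃ u, X.graph.Adj u a ∧ X.graph.dist b a = X.graph.dist b u + 1 ∧
        X.side u a ∉ A
    · obtain ⟨u, hua, hdu, huA⟩ := hmove
      refine ih (a := u) (fun S hS => ⟨(hA S hS).1, fun hu => huA ?_, (hA S hS).2.2⟩) (by omega)
      rwa [← hX.side_eq_of_crossing (hA S hS).1 hua hu (hA S hS).2.1]
    · push Not at hmove
      have hex : ∀ S ∈ A, ∃ u, X.graph.Adj u a ∧ X.graph.dist b a = X.graph.dist b u + 1 ∧
          S = X.side u a := fun S hS => by
        obtain ⟨u, hua, hdu, hsub⟩ := hX.exists_subset_side (hA S hS)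
        refine ⟨u, hua, hdu, ?_⟩
        by_contra hne
        exact hanti hS (hmove u hua hdu) hne hsub
      have : Nonempty V := ⟨a⟩
      choose! f hf using hex
      rw [← Finset.card_image_of_injOn (f := f) fun S hS T hT h => by
        rw [(hf S hS).2.2, (hf T hT).2.2, h]]
      refine hX.card_toward_le hd (b := b) (v := a) _ fun u hu => ?_
      obtain ⟨S, hS, rfl⟩ := Finset.mem_image.1 hu
      exact ⟨(hf S hS).1.symm, (hf S hS).2.1⟩

/-- More than `D * d` halfspaces separating two vertices contain a pencil of `D + 1` halfspaces. -/
lemma IsCAT0.exists_pencil (hX : X.IsCAT0) {d D : ℕ} (hd : X.HasDim d) {a b : V}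
    {T : Set (Set V)} (hT : T ⊆ X.sepSides a b) (hcard : D * d < T.ncard) :
    ∃ f : Fin (D + 1) → Set V, StrictMono f ∧ ∀ i, f i ∈ T := by
  have hfin : T.Finite := (hX.finite_sepSides a b).subset hT
  obtain ⟨f, hf, hfT⟩ := exists_strictMono_of_antichain_le (w := d) D (T := hfin.toFinset)
    (fun A hA hanti => hX.card_antichain_le hd (a := a) (b := b)
      (fun S hS => hT (by simpa using hA hS)) hanti)
    (by rwa [← Set.ncard_eq_toFinset_card T hfin])
  exact ⟨f, hf, fun i => by simpa using hfT i⟩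

/-- Two pencils of pairwise crossing halfspaces form a grid. -/
lemma IsCAT0.hasGrid (hX : X.IsCAT0) {m : ℕ} {f g : Fin m → Set V} (hf : StrictMono f)
    (hg : StrictMono g) (hfs : ∀ i, X.IsSide (f i)) (hgs : ∀ i, X.IsSide (g i))
    (hfg : ∀ i j, Crosses (f i) (g j)) : X.HasGrid m := by
  choose h hh using fun i => hX.exists_halfspace (hfs i)
  choose k hk using fun i => hX.exists_halfspace (hgs i)
  refine ⟨h, k, fun i j hij => ?_, fun i j hij => ?_, fun i j => ?_⟩
  · change (h i).carrier < (h j).carrier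
    rw [hh, hh]
    exact hf hij
  · change (k i).carrier < (k j).carrier
    rw [hk, hk]
    exact hg hij
  · rw [hX.transverse_iff, hh, hk]
    exact hfg i j

lemma carrier_strictMono {m : ℕ} {h : Fin m → X.Halfspace} (hh : StrictMono h) :
    StrictMono fun i => (h i).carrier := fun _ _ hij => hh hij

lemma IsCAT0.card_le_dist (hX : X.IsCAT0) {m : ℕ} {f : Fin m → Set V} (hf : StrictMono f) {u v : V}
    (hs : ∀ i, f i ∈ X.sepSides u v) : m ≤ X.graph.dist u v := by
  rw [← hX.ncard_sepSides]
  calc m = (Set.range f).ncard := by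
        rw [← Set.image_univ, Set.ncard_image_of_injective _ hf.injective, Set.ncard_univ]
        simp
    _ ≤ _ := Set.ncard_le_ncard (by rintro _ ⟨i, rfl⟩; exact hs i) (hX.finite_sepSides u v)

lemma IsCAT0.exists_walk_through (hX : X.IsCAT0) {x z w : V} (h : w ∈ X.interval x z) :
    ∃ p : X.graph.Walk x z, p.length = X.graph.dist x z ∧ w ∈ p.support := by
  obtain ⟨p, hp⟩ := hX.1.1.exists_walk_length_eq_dist x w
  obtain ⟨q, hq⟩ := hX.1.1.exists_walk_length_eq_dist w z
  exact ⟨p.append q, by rw [SimpleGraph.Walk.length_append, hp, hq, mem_interval.1 h],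
    by simp⟩

lemma mem_interval_of_mem_support (hX : X.IsCAT0) {x z v : V} {p : X.graph.Walk x z}
    (hp : p.length = X.graph.dist x z) (hv : v ∈ p.support) : v ∈ X.interval x z := by
  classical
  have h := congrArg SimpleGraph.Walk.length (p.take_spec hv)
  rw [SimpleGraph.Walk.length_append, hp] at h
  have h1 := SimpleGraph.dist_le (p.takeUntil v hv)
  have h2 := SimpleGraph.dist_le (p.dropUntil v hv)
  have h3 := hX.1.1.dist_triangle (u := x) (v := v) (w := z)
  exact mem_interval.2 (by omega)

/-- In a `δ`-hyperbolic complex grids have size at most `δ`: opposite corners `x, z` of a grid and a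
third corner `w` between them lie in a geodesic triangle whose other two sides run along the two
sides of the grid that avoid `w`. -/
theorem IsCAT0.le_of_hasGrid (hX : X.IsCAT0) {δ : ℝ} (hδ : X.Hyperbolic δ) {m : ℕ}
    (hm : X.HasGrid m) : (m : ℝ) ≤ max δ 0 := by
  rcases Nat.eq_zero_or_pos m with rfl | hpos
  · simp
  refine le_max_of_le_left ?_
  obtain ⟨n, rfl⟩ : ∃ n, m = n + 1 := ⟨m - 1, by omega⟩
  obtain ⟨h, k, hh, hk, hT⟩ := hm
  have hsh := fun i => (hX.exists_side (h i)).1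
  have hsk := fun i => (hX.exists_side (k i)).1
  have hc := fun i j => (hX.transverse_iff (h i) (k j)).1 (hT i j)
  have hmh := (carrier_strictMono hh).monotone
  have hmk := (carrier_strictMono hk).monotone
  obtain ⟨x, hx1, hx2⟩ := (hc 0 0).1
  obtain ⟨w', hw1, hw2⟩ := (hc 0 (Fin.last n)).2.1
  obtain ⟨y, hy1, hy2⟩ := (hc (Fin.last n) 0).2.2.1
  obtain ⟨z, hz1, hz2⟩ := (hc (Fin.last n) (Fin.last n)).2.2.2
  obtain ⟨w, hw⟩ := hX.exists_isGate (hX.isConvex_interval x z) ⟨x, left_mem_interval x z⟩ w'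
  have hw1' : w ∈ (h 0).carrier :=
    hw.mem_of_mem hX (hsh 0) hw1 (left_mem_interval x z) hx1
  have hw2' : w ∉ (k (Fin.last n)).carrier :=
    hw.notMem_of_notMem hX (hsk _) hw2 (right_mem_interval x z) hz2
  obtain ⟨r, hr, hwr⟩ := hX.exists_walk_through hw.1
  obtain ⟨p, hp⟩ := hX.1.1.exists_walk_length_eq_dist x y
  obtain ⟨q, hq⟩ := hX.1.1.exists_walk_length_eq_dist z y
  obtain ⟨v, hv, hd⟩ := hδ x z y r q p hr hq hp w hwr
  refine le_trans ?_ hd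
  norm_cast
  rcases hv with hv | hv
  · have hv' : v ∉ (h (Fin.last n)).carrier :=
      hX.isConvex_side (hX.isSide_compl (hsh _)) z hz1 y hy1 (mem_interval_of_mem_support hX hq hv)
    rw [SimpleGraph.dist_comm]
    exact hX.card_le_dist (carrier_strictMono hh) fun i =>
      ⟨hsh i, fun hi => hv' (hmh (Fin.le_last i) hi), hmh (Fin.zero_le i) hw1'⟩
  · have hv' : v ∈ (k 0).carrier :=
      hX.isConvex_side (hsk _) x hx2 y hy2 (mem_interval_of_mem_support hX hp hv)
    exact hX.card_le_dist (carrier_strictMono hk) fun i =>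
      ⟨hsk i, fun hi => hw2' (hmk (Fin.le_last i) hi), hmk (Fin.zero_le i) hv'⟩

lemma hasGrid_zero : X.HasGrid 0 :=
  ⟨finZeroElim, finZeroElim, fun i => i.elim0, fun i => i.elim0, fun i => i.elim0⟩

theorem IsCAT0.bddAbove_hasGrid (hX : X.IsCAT0) {δ : ℝ} (hδ : X.Hyperbolic δ) :
    ∀ m ∈ {m | X.HasGrid m}, m ≤ ⌊δ⌋₊ := by
  intro m hm
  have := hX.le_of_hasGrid hδ hm
  rcases le_total δ 0 with h | h
  · rw [max_eq_right h] at this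
    have : m = 0 := by exact_mod_cast le_antisymm this (by positivity)
    omega
  · rw [max_eq_left h] at this
    exact Nat.le_floor this

theorem IsCAT0.isGreatest_gridNumber (hX : X.IsCAT0) {δ : ℝ} (hδ : X.Hyperbolic δ) :
    IsGreatest {m : ℕ | X.HasGrid m} X.gridNumber :=
  ⟨Nat.sSup_mem ⟨0, hasGrid_zero⟩ ⟨_, hX.bddAbove_hasGrid hδ⟩,
    fun _ hm => le_csSup ⟨_, hX.bddAbove_hasGrid hδ⟩ hm⟩

/-- Balls in intervals are finite, with a bound depending only on the radius and the dimension. -/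
lemma IsCAT0.encard_ball_inter_interval_le (hX : X.IsCAT0) {d : ℕ} (hd : X.HasDim d) (x y c : V)
    (hc : c ∈ X.interval x y) (R : ℕ) :
    {v | v ∈ X.interval x y ∧ X.graph.dist v c ≤ R}.encard ≤ ((2 * d + 1) ^ R : ℕ) := by
  classical
  have hnear : ∀ a b : V, ∃ N : Finset V, N.card ≤ d ∧
      ∀ u, X.graph.Adj a u → X.graph.dist b a = X.graph.dist b u + 1 → u ∈ N := by
    intro a b
    have hfin : {u | X.graph.Adj a u ∧ X.graph.dist b a = X.graph.dist b u + 1}.Finite := by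
      by_contra hinf
      obtain ⟨t, ht, hcard⟩ := (Set.not_finite.1 hinf).exists_subset_card_eq (d + 1)
      have := hX.card_toward_le hd (b := b) (v := a) t fun u hu => ht hu
      omega
    refine ⟨hfin.toFinset, hX.card_toward_le hd (b := b) (v := a) _ fun u hu => by simpa using hu,
      fun u h1 h2 => by simp [h1, h2]⟩
  choose N hN hmem using hnear
  suffices h : ∃ T : Finset V, T.card ≤ (2 * d + 1) ^ R ∧
      ∀ v ∈ X.interval x y, X.graph.dist v c ≤ R → v ∈ T by
    obtain ⟨T, hT, hsub⟩ := h
    calc _ ≤ (T : Set V).encard := Set.encard_le_encard fun v hv => hsub v hv.1 hv.2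
      _ = (T.card : ℕ∞) := Set.encard_coe_eq_coe_finsetCard T
      _ ≤ _ := by exact_mod_cast hT
  induction R with
  | zero =>
    refine ⟨{c}, by simp, fun v _ h => ?_⟩
    simpa using (hX.1.1.dist_eq_zero_iff).1 (Nat.le_zero.1 h)
  | succ R ih =>
    obtain ⟨T, hT, hsub⟩ := ih
    refine ⟨T.biUnion fun u => insert u (N u x ∪ N u y), ?_, fun v hv hdist => ?_⟩
    · calc _ ≤ T.card * (2 * d + 1) := Finset.card_biUnion_le_card_mul _ _ _ fun u _ => by
            have h1 := Finset.card_insert_le u (N u x ∪ N u y)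
            have h2 := Finset.card_union_le (N u x) (N u y)
            have h3 := hN u x
            have h4 := hN u y
            omega
        _ ≤ _ := by rw [pow_succ]; gcongr
    · rw [Finset.mem_biUnion]
      rcases eq_or_ne v c with rfl | hne
      · exact ⟨v, hsub v hv (by simp), by simp⟩
      obtain ⟨u, hvu, hdu⟩ := hX.exists_toward hne
      have hu : u ∈ X.interval x y := hX.isConvex_interval x y v hv c hc (mem_interval.2 (by
        rw [hdu, SimpleGraph.dist_eq_one_iff_adj.2 hvu, add_comm]))
      refine ⟨u, hsub u hu (by omega), ?_⟩
      simp only [Finset.mem_insert, Finset.mem_union]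
      right
      rw [mem_interval] at hv hu
      have h1 := hX.dist_adj x hvu
      have h2 := hX.dist_adj_left y hvu
      rcases h1 with h1 | h1
      · exact .inl (hmem u x v hvu.symm h1)
      · refine .inr (hmem u y v hvu.symm ?_)
        rw [SimpleGraph.dist_comm (u := y), SimpleGraph.dist_comm (u := y)]
        omega

end CubeComplex

/-! ### Projections of peripheral halfspaces -/

namespace CubeComplex

variable {V : Type*} {X : CubeComplex V}

lemma IsCAT0.mem_proj_iff (hX : X.IsCAT0) {x y p : V} {h : X.Halfspace} :
    p ∈ X.proj x y h ↔ ∃ v ∈ h.carrier, X.IsGate (X.interval x y) v p := by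
  constructor
  · rintro ⟨hp, v, hv, hmin⟩
    exact ⟨v, hv, hX.isGate_of_nearest (hX.isConvex_interval x y) hp hmin⟩
  · rintro ⟨v, hv, hg⟩
    exact ⟨hg.1, v, hv, fun q hq => hg.dist_le hq⟩

/-- The gate of `z` in the interval is the median of `x`, `y`, `z`; its distance from `x` is
`(y.z)_x`. -/
lemma IsGate.gromovProduct_eq {x y z m : V}
    (hm : X.IsGate (X.interval x y) z m) : X.gromovProduct x y z = X.graph.dist x m := by
  have h1 := mem_interval.1 hm.1
  have h2 := mem_interval.1 (hm.2 x (left_mem_interval x y))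
  have h3 := mem_interval.1 (hm.2 y (right_mem_interval x y))
  have h4 : X.graph.dist x z = X.graph.dist z x := SimpleGraph.dist_comm
  have h5 : X.graph.dist y z = X.graph.dist z y := SimpleGraph.dist_comm
  have h6 : X.graph.dist m x = X.graph.dist x m := SimpleGraph.dist_comm
  rw [gromovProduct, h4, h5, h1, h2, h3, h6]
  push_cast
  ring

lemma Crosses.compl_right {S T : Set V} (h : Crosses S T) : Crosses S Tᶜ := by
  obtain ⟨h1, h2, h3, h4⟩ := h
  exact ⟨h2, by rwa [compl_compl], h4, by rwa [compl_compl]⟩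

lemma IsCAT0.notMem_of_mem_interval (hX : X.IsCAT0) {S : Set V} (hS : X.IsSide S) {x y p : V}
    (hp : p ∈ X.interval x y) (hx : x ∉ S) (hy : y ∉ S) : p ∉ S :=
  hX.isConvex_side (hX.isSide_compl hS) x hx y hy hp

/-- The intersection number bounds the pencils of separating sides that cross the halfspace. -/
lemma IsCAT0.le_of_interNumber_le (hX : X.IsCAT0) {h : X.Halfspace} {x y : V} {D n : ℕ}
    (hD : X.interNumber h (X.sepHalfspaces x y) ≤ D) {f : Fin n → Set V} (hf : StrictMono f)
    (hs : ∀ i, f i ∈ X.sepSides x y) (hc : ∀ i, Crosses h.carrier (f i)) : n ≤ D := by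
  choose k hk using fun i => hX.exists_halfspace (hs i).1
  have : (n : ℕ∞) ≤ D := by
    refine (le_sSup (α := ℕ∞) ?_).trans hD
    refine ⟨n, k, rfl, fun i j hij => ?_, fun i => ⟨⟨?_, ?_⟩, ?_⟩⟩
    · change (k i).carrier < (k j).carrier
      rw [hk, hk]
      exact hf hij
    · rw [hk]; exact (hs i).2.1
    · rw [hk]; exact (hs i).2.2
    · rw [hX.transverse_iff, hk]; exact hc i
  exact_mod_cast this

/-- The projection of a `D`-peripheral halfspace has diameter at most `D * d`. -/
lemma IsCAT0.dist_le_of_mem_proj (hX : X.IsCAT0) {d D : ℕ} (hd : X.HasDim d) {x y p p' : V}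
    {h : X.Halfspace} (hh : h ∈ X.peripheralOf D x y) (hp : p ∈ X.proj x y h)
    (hp' : p' ∈ X.proj x y h) : X.graph.dist p p' ≤ D * d := by
  by_contra! hlt
  obtain ⟨w, hwh, hw⟩ := hX.mem_proj_iff.1 hp
  obtain ⟨w', hwh', hw'⟩ := hX.mem_proj_iff.1 hp'
  obtain ⟨⟨hx, hy⟩, hD⟩ := hh
  have hsh := (hX.exists_side h).1
  rw [← hX.ncard_sepSides] at hlt
  obtain ⟨f, hf, hfs⟩ := hX.exists_pencil hd subset_rfl hlt
  have hc : ∀ i, Crosses h.carrier (f i) := by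
    intro i
    obtain ⟨hS, hpS, hpS'⟩ := hfs i
    refine ⟨⟨w', hwh', ?_⟩, ⟨w, hwh, ?_⟩,
      ⟨p', hX.notMem_of_mem_interval hsh hw'.1 hx hy, hpS'⟩,
      ⟨p, hX.notMem_of_mem_interval hsh hw.1 hx hy, hpS⟩⟩
    · by_contra hcon
      exact hw'.notMem_of_notMem hX hS hcon hw.1 hpS hpS'
    · exact fun hcon => hpS (hw.mem_of_mem hX hS hcon hw'.1 hpS')
  have hsep : ∀ i, x ∈ f i ↔ y ∉ f i := by
    intro i
    obtain ⟨hS, hpS, hpS'⟩ := hfs i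
    have h1 : x ∈ f i → y ∈ f i → p ∈ f i := fun hx hy => hX.isConvex_side hS x hx y hy hw.1
    have h2 := hX.notMem_of_mem_interval hS (x := x) (y := y) hw'.1
    tauto
  -- all members of the pencil contain the same one of `x` and `y`
  by_cases hxl : x ∈ f (Fin.last D)
  · have hy' : ∀ i, y ∉ f i := fun i hi => (hsep _).1 hxl (hf.monotone (Fin.le_last i) hi)
    have := hX.le_of_interNumber_le hD (f := fun i => (f (Fin.rev i))ᶜ)
      (fun i j hij => compl_lt_compl_iff_lt.2 (hf (Fin.rev_lt_rev.2 hij)))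
      (fun i => ⟨hX.isSide_compl (hfs _).1, fun hx' => hx' ((hsep _).2 (hy' _)), hy' _⟩)
      (fun i => (hc _).compl_right)
    omega
  · have hx' : ∀ i, x ∉ f i := fun i hi => hxl (hf.monotone (Fin.le_last i) hi)
    have := hX.le_of_interNumber_le hD hf
      (fun i => ⟨(hfs i).1, hx' i, by have := hsep i; have := hx' i; tauto⟩) hc
    omega

/-- If the halfspaces of a pencil of size `D + 1` contain `z` and avoid the interval, then the
gates of `z` and of any point of the smallest one are near each other: the halfspaces separating
these gates cross the pencil. -/
lemma IsCAT0.dist_gate_le (hX : X.IsCAT0) {d D : ℕ} (hd : X.HasDim d) (hG : ¬ X.HasGrid (D + 1))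
    {x y z w p m : V} {k : Fin (D + 1) → Set V} (hk : StrictMono k) (hks : ∀ i, X.IsSide (k i))
    (hx : ∀ i, x ∉ k i) (hy : ∀ i, y ∉ k i) (hz : ∀ i, z ∈ k i) (hw : w ∈ k 0)
    (hp : X.IsGate (X.interval x y) w p) (hm : X.IsGate (X.interval x y) z m) :
    X.graph.dist p m ≤ D * d := by
  by_contra! hlt
  rw [← hX.ncard_sepSides] at hlt
  obtain ⟨f, hf, hfs⟩ := hX.exists_pencil hd subset_rfl hlt
  refine hG (hX.hasGrid hf hk (fun i => (hfs i).1) hks fun i j => ?_)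
  obtain ⟨hS, hpS, hmS⟩ := hfs i
  refine ⟨⟨z, ?_, hz j⟩, ⟨m, hmS, hX.notMem_of_mem_interval (hks j) hm.1 (hx j) (hy j)⟩,
    ⟨w, ?_, hk.monotone (Fin.zero_le j) hw⟩,
    ⟨p, hpS, hX.notMem_of_mem_interval (hks j) hp.1 (hx j) (hy j)⟩⟩
  · by_contra hcon
    exact hm.notMem_of_notMem hX hS hcon hp.1 hpS hmS
  · exact fun hcon => hpS (hp.mem_of_mem hX hS hcon hm.1 hmS)

/-- Let `q` be the gate of `x` in the smallest halfspace of a pencil of size `D + 1` avoiding `x`.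
Then the gate `p` of a point `w` of that halfspace is near the gate `c` of `q`, if it is near a
point off the pencil: the halfspaces separating `c` from `p` and its neighbour `p'` cross the
pencil. -/
lemma IsCAT0.dist_gate_gate_le (hX : X.IsCAT0) {d D : ℕ} (hd : X.HasDim d)
    (hG : ¬ X.HasGrid (D + 1)) {I : Set V} {x w p p' q c : V} {k : Fin (D + 1) → Set V}
    (hk : StrictMono k) (hks : ∀ i, X.IsSide (k i)) (hx : ∀ i, x ∉ k i) (hw : w ∈ k 0)
    (hp : X.IsGate I w p) (hp' : p' ∉ k (Fin.last D))
    (hq : X.IsGate (k 0) x q) (hc : X.IsGate I q c) (hpp : X.graph.dist p' p ≤ D * d) :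
    X.graph.dist p c ≤ 2 * (D * d) := by
  by_contra! hlt
  rw [SimpleGraph.dist_comm, ← hX.ncard_sepSides] at hlt
  rw [← hX.ncard_sepSides] at hpp
  have hsub : X.sepSides c p ⊆ {S ∈ X.sepSides c p | p' ∈ S} ∪ X.sepSides p' p := by
    intro S hS
    by_cases h : p' ∈ S
    · exact .inl ⟨hS, h⟩
    · exact .inr ⟨hS.1, h, hS.2.2⟩
  have hcard := (Set.ncard_le_ncard hsub (((hX.finite_sepSides c p).subset
    (Set.sep_subset _ _)).union (hX.finite_sepSides p' p))).trans (Set.ncard_union_le _ _)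
  obtain ⟨f, hf, hfs⟩ := hX.exists_pencil (D := D) hd (T := {S ∈ X.sepSides c p | p' ∈ S})
    (Set.sep_subset _ _) (by omega)
  refine hG (hX.hasGrid hf hk (fun i => (hfs i).1.1) hks fun i j => ?_)
  obtain ⟨⟨hS, hcS, hpS⟩, hpS'⟩ := hfs i
  have hqS : q ∉ f i := fun h => hcS (hc.mem_of_mem hX hS h hp.1 hpS)
  have hwS : w ∈ f i := by
    by_contra hcon
    exact hp.notMem_of_notMem hX hS hcon hc.1 hcS hpS
  have hxS : x ∉ f i := fun h => hqS (hq.mem_of_mem hX hS h hw hwS)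
  exact ⟨⟨w, hwS, hk.monotone (Fin.zero_le j) hw⟩,
    ⟨p', hpS', fun h => hp' (hk.monotone (Fin.le_last j) h)⟩,
    ⟨q, hqS, hk.monotone (Fin.zero_le j) hq.1⟩, ⟨x, hxS, hx j⟩⟩

variable (X) in
/-- The halfspaces that contain `z` but neither `x` nor `y` and whose projection to the interval
between `x` and `y` reaches further than `r` from the projection `m` of `z`. -/
def farSides (x y z m : V) (r : ℕ) : Set (Set V) :=
  {S | X.IsSide S ∧ x ∉ S ∧ y ∉ S ∧ z ∈ S ∧
    ∃ w ∈ S, ∃ p, X.IsGate (X.interval x y) w p ∧ r < X.graph.dist p m}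

lemma IsCAT0.ncard_farSides_le (hX : X.IsCAT0) {d D : ℕ} (hd : X.HasDim d)
    (hG : ¬ X.HasGrid (D + 1)) {x y z m : V} (hm : X.IsGate (X.interval x y) z m) :
    (X.farSides x y z m (D * d)).ncard ≤ D * d := by
  by_contra! hlt
  obtain ⟨f, hf, hfs⟩ := hX.exists_pencil (a := x) (b := z) hd
    (fun S hS => ⟨hS.1, hS.2.1, hS.2.2.2.1⟩) hlt
  obtain ⟨w, hw, p, hp, hpm⟩ := (hfs 0).2.2.2.2
  exact hpm.not_ge (hX.dist_gate_le hd hG hf (fun i => (hfs i).1) (fun i => (hfs i).2.1)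
    (fun i => (hfs i).2.2.1) (fun i => (hfs i).2.2.2.1) hw hp hm)

/-- The projections counted in the theorem are located near the projection of the gate of `x` in
one of the finitely many `farSides`. -/
lemma IsCAT0.exists_farSide (hX : X.IsCAT0) {d D : ℕ} (hd : X.HasDim d)
    (hG : ¬ X.HasGrid (D + 1)) {x y z m : V} (hm : X.IsGate (X.interval x y) z m) {h : X.Halfspace}
    (hh : h ∈ X.peripheralNear D (X.gromovProduct x y z - (D : ℝ) * (d : ℝ)) x y)
    (hz : h ∉ X.peripheralOf D x z) :
    ∃ S ∈ X.farSides x y z m (D * d), ∀ q c, X.IsGate S x q → X.IsGate (X.interval x y) q c →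
      ∀ a ∈ X.proj x y h, X.graph.dist a c ≤ 3 * (D * d) := by
  obtain ⟨hper, hnear⟩ := hh
  have hgate : ∀ v, ∃ g, X.IsGate (X.interval x y) v g := fun v =>
    hX.exists_isGate (hX.isConvex_interval x y) ⟨x, left_mem_interval x y⟩ v
  have hfar : ∀ a ∈ X.proj x y h, D * d < X.graph.dist a m := by
    intro a ha
    have h1 := hnear a ha
    rw [hm.gromovProduct_eq] at h1
    have h2 := hX.1.1.dist_triangle (u := x) (v := a) (w := m)
    have h3 : ((X.graph.dist x a + D * d : ℕ) : ℝ) < X.graph.dist x m := by push_cast; linarith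
    have h4 : X.graph.dist x a + D * d < X.graph.dist x m := by exact_mod_cast h3
    omega
  have hzh : z ∉ h.carrier := fun hzh => by
    simpa using hfar m (hX.mem_proj_iff.2 ⟨z, hzh, hm⟩)
  have hlt : (D : ℕ∞) < X.interNumber h (X.sepHalfspaces x z) :=
    not_le.1 fun hle => hz ⟨⟨hper.1.1, hzh⟩, hle⟩
  obtain ⟨_, ⟨n, k', rfl, hk', hks'⟩, hn⟩ := lt_sSup_iff.1 hlt
  have hn : D + 1 ≤ n := by exact_mod_cast hn
  set k : Fin (D + 1) → Set V := fun i => (k' (Fin.castLE hn i)).carrier with hkdef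
  have hk : StrictMono k := fun i j hij => hk' (Fin.castLE_lt_castLE_iff hn |>.2 hij)
  have hks : ∀ i, X.IsSide (k i) := fun i => (hX.exists_side _).1
  have hkx : ∀ i, x ∉ k i := fun i => (hks' _).1.1
  have hkz : ∀ i, z ∈ k i := fun i => (hks' _).1.2
  have hkc : ∀ i, Crosses h.carrier (k i) := fun i => (hX.transverse_iff _ _).1 (hks' _).2
  have hy0 : y ∉ k 0 := fun hy0 => by
    have := hX.le_of_interNumber_le hper.2 hk
      (fun i => ⟨hks i, hkx i, hk.monotone (Fin.zero_le i) hy0⟩) hkc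
    omega
  obtain ⟨w, hwh, hw⟩ := (hkc 0).1
  obtain ⟨w', hwh', hw'⟩ := (hkc (Fin.last D)).2.1
  obtain ⟨p, hp⟩ := hgate w
  obtain ⟨p', hp'⟩ := hgate w'
  have hpp := hX.mem_proj_iff.2 ⟨w, hwh, hp⟩
  have hpp' := hX.mem_proj_iff.2 ⟨w', hwh', hp'⟩
  refine ⟨k 0, ⟨hks 0, hkx 0, hy0, hkz 0, w, hw, p, hp, hfar p hpp⟩, fun q c hq hc a ha => ?_⟩
  have h1 := hX.dist_gate_gate_le hd hG hk hks hkx hw hp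
    (hp'.notMem_of_notMem hX (hks _) hw' (left_mem_interval x y) (hkx _)) hq hc
    (hX.dist_le_of_mem_proj hd hper hpp' hpp)
  have h2 := hX.dist_le_of_mem_proj hd hper ha hpp
  have h3 := hX.1.1.dist_triangle (u := a) (v := p) (w := c)
  omega

theorem IsCAT0.encard_projections_le (hX : X.IsCAT0) {d D : ℕ} (hd : X.HasDim d)
    (hG : ¬ X.HasGrid (D + 1)) (x y z : V) :
    {A : Set V | ∃ h ∈ X.peripheralNear D (X.gromovProduct x y z - (D : ℝ) * (d : ℝ)) x y \
        X.peripheralOf D x z, A = X.proj x y h}.encard ≤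
      ((D * d * 2 ^ ((2 * d + 1) ^ (3 * (D * d))) : ℕ) : ℕ∞) := by
  classical
  have hgate : ∀ v, ∃ g, X.IsGate (X.interval x y) v g := fun v =>
    hX.exists_isGate (hX.isConvex_interval x y) ⟨x, left_mem_interval x y⟩ v
  obtain ⟨m, hm⟩ := hgate z
  set K := X.farSides x y z m (D * d) with hK
  have hKfin : K.Finite := (hX.finite_sepSides x z).subset
    fun S hS => ⟨hS.1, hS.2.1, hS.2.2.2.1⟩
  have hKcard : hKfin.toFinset.card ≤ D * d := by
    rw [← Set.ncard_eq_toFinset_card K hKfin]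
    exact hX.ncard_farSides_le hd hG hm
  have hball : ∀ S ∈ K, ∃ B : Finset V, B.card ≤ (2 * d + 1) ^ (3 * (D * d)) ∧
      ∀ A : Set V, A ⊆ X.interval x y → (∀ q c, X.IsGate S x q → X.IsGate (X.interval x y) q c →
        ∀ a ∈ A, X.graph.dist a c ≤ 3 * (D * d)) → A ⊆ B := by
    intro S hS
    obtain ⟨q, hq⟩ := hX.exists_isGate (hX.isConvex_side hS.1) ⟨z, hS.2.2.2.1⟩ x
    obtain ⟨c, hc⟩ := hgate q
    have hle := hX.encard_ball_inter_interval_le hd x y c hc.1 (3 * (D * d))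
    have hfin := Set.finite_of_encard_le_coe hle
    refine ⟨hfin.toFinset, ?_, fun A hA hAc a ha => ?_⟩
    · rw [hfin.encard_eq_coe_toFinset_card] at hle
      exact_mod_cast hle
    · simpa using ⟨hA ha, hAc q c hq hc a ha⟩
  choose! B hBcard hB using hball
  set T : Finset (Set V) := hKfin.toFinset.biUnion fun S =>
    (B S).powerset.image fun s : Finset V => (s : Set V) with hT
  calc _ ≤ (T : Set (Set V)).encard := by
        refine Set.encard_le_encard ?_
        rintro A ⟨h, ⟨hh, hz⟩, rfl⟩
        obtain ⟨S, hS, hSa⟩ := hX.exists_farSide hd hG hm hh hz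
        have hsub := hB S hS (X.proj x y h) (fun a ha => ha.1) hSa
        rw [Finset.mem_coe, Finset.mem_biUnion]
        refine ⟨S, by simpa using hS, Finset.mem_image.2 ⟨((B S).finite_toSet.subset hsub).toFinset,
          ?_, by simp⟩⟩
        rw [Finset.mem_powerset]
        intro a ha
        exact hsub (by simpa using ha)
    _ = (T.card : ℕ∞) := Set.encard_coe_eq_coe_finsetCard T
    _ ≤ _ := by
      norm_cast
      calc T.card ≤ hKfin.toFinset.card * 2 ^ ((2 * d + 1) ^ (3 * (D * d))) :=
            Finset.card_biUnion_le_card_mul _ _ _ fun S hS => by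
              refine Finset.card_image_le.trans ?_
              rw [Finset.card_powerset]
              exact Nat.pow_le_pow_right (by norm_num) (hBcard S (by simpa using hS))
        _ ≤ _ := Nat.mul_le_mul_right _ hKcard

end CubeComplex

theorem mainTheorem2 (δ : ℝ) (d : ℕ) :
    ∃ M : ℕ, ∀ (V : Type*) (X : CubeComplex V),
      X.IsCAT0 → X.HasDim d → X.Hyperbolic δ →
        IsGreatest {m : ℕ | X.HasGrid m} X.gridNumber ∧
        ∀ x y z : V,
          {A : Set V | ∃ h ∈
              X.peripheralNear X.gridNumber
                  (X.gromovProduct x y z - (X.gridNumber : ℝ) * (d : ℝ)) x y \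
                X.peripheralOf X.gridNumber x z,
            A = X.proj x y h}.encard ≤ (M : ℕ∞) := by
  refine ⟨∑ D ∈ Finset.range (⌊δ⌋₊ + 1), D * d * 2 ^ ((2 * d + 1) ^ (3 * (D * d))),
    fun V X hX hd hδ => ?_⟩
  have hgreat := hX.isGreatest_gridNumber hδ
  refine ⟨hgreat, fun x y z => (hX.encard_projections_le hd
    (fun hG => Nat.not_succ_le_self _ (hgreat.2 hG)) x y z).trans ?_⟩
  have hD := hX.bddAbove_hasGrid hδ _ hgreat.1
  exact_mod_cast Finset.single_le_sum
    (f := fun D => D * d * 2 ^ ((2 * d + 1) ^ (3 * (D * d)))) (fun _ _ => Nat.zero_le _)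
    (Finset.mem_range.2 (Nat.lt_succ_of_le hD))
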